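/- \textbf{Setting.} Let $\Sigma$ be an order-sorted signature with sorts $\mathsf{Fact}$ and $\mathsf{Bool}$, and let $\mathcal D$ be a $\Sigma$-algebra of facts given by equational attributes $A$ and conditional equalities $E$, used as simplification rules: simplification modulo $A$ terminates, does not lose sorts and is confluent modulo $A$ on ground terms; every ground term of sort $\mathsf{Bool}$ equals exactly one of $\mathsf{true},\mathsf{false}$ modulo $A\cup E$; and for each sort there is a $\mathsf{Bool}$-valued equality symbol that is interpreted by equality. The values of sort $s$ are the ground terms of sort $s$ modulo $A\cup E$. (Data may contain additional symbols, such as constructors of nominal values, that are not allowed in queries.) \emph{Conditions} are $\mathsf{False}$, $\{B\}$ ($B$ a term of sort $\mathsf{Bool}$), $\neg\psi$, $\psi_1\vee\psi_2$, $\exists P.\psi$. \emph{Queries} of the query sublanguage are $\emptyset$, $f$ (a term of sort $\mathsf{Fact}$), $Q_1\rhd Q_2$, $\phi\Rightarrow Q$ ($\phi$ a condition), $\mathsf{From}\ P.\,Q$. In both, $P=[P_!]_!\circ[P_?]_?$ consists of finite multisets $P_!$, $P_?$ of terms of sort $\mathsf{Fact}$ with $P_?\neq\emptyset$. A quantifier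 binds the variables of $P$ in its scope; a query is \emph{closed} if every variable in its terms $f$, $B$ is bound. It is \emph{deterministic} if every pattern $P$ in it, also inside conditions, is $[f]_?$ for a single fully reduced fact term $f$ with the \emph{unique matching property}: for each fully reduced ground fact $g$, any two substitutions $\sigma$ of ground terms for the variables of $f$ with $\sigma(f)=_Ag$ agree modulo $A$. A closed query $Q$ is evaluated on a finite multiset $F$ of ground facts by rewriting $\mathrm{Init}_Q(F)=\{F,\emptyset,[\,]_Q\}$. A state $\{F,F',S\}$ consists of the database $F$, the partial answer $F'$ and a stack $S$ of frames; each frame carries a subquery and the current substitution $\sigma$. The top frame is rewritten as follows. For $f$ the fact $\sigma(f)$ is added to $F'$ and the frame is removed. For $\emptyset$ the frame is removed. For $Q_1\rhd Q_2$ the frame is replaced by frames for $Q_2$ and, on top, $Q_1$. For $\phi\Rightarrow R$ the condition $\phi$ is first evaluated on $F$; the frame is then replaced by one for $R$ if the result is true, and removed if it is false. For $\mathsf{From}\ P.\,R$ an iterator frame with iterator state $F''=F$ is created. As long as $F''=G\circ\sigma'(P_!)\circ\sigma'(P_?)$ for some multiset $G$ and some extension $\sigma'$ of $\sigma$ (matching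 fully reduced facts modulo $A$), some such $G,\sigma'$ are chosen, the iterator state becomes $G\circ\sigma'(P_!)$, and a frame for $R$ with substitution $\sigma'$ is pushed; when no match exists the iterator frame is removed. $\{F,F',S\}$ with empty stack $S$ is rewritten to $\mathrm{Ans}(F')$. Conditions are evaluated by analogous stack rewriting: $\{B\}$ gives the truth value of $\sigma(B)$, $\neg$ negates, $\psi_1\vee\psi_2$ evaluates $\psi_2$ and, if this is false, $\psi_1$; $\exists P.\psi$ iterates over matches like $\mathsf{From}$, starting with the whole database $F$, stops with true as soon as $\psi$ is true for a match, and gives false when no match is left. Write $X\to^!Y$ if $X$ rewrites in finitely many steps to $Y$ and $Y$ cannot be rewritten. Let $\mathcal S$ be a finite relational schema, each relation symbol having a finite list of column sorts. Relational algebra expressions over $\mathcal S$ and $\mathcal D$ are built, with positional columns, from the relation symbols of $\mathcal S$ by projection $\pi_{i_1,\dots,i_k}$, selection $\sigma_\phi$ ($\phi$ a term of sort $\mathsf{Bool}$ in variables $\$_1,\dots,\$_n$ of the column sorts), union and difference (of expressions with the same column sorts) and Cartesian product. A database $I$ assigns to each relation symbol $r$ a finite set $r^I$ of tuples of values of its column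 sorts, and $\mathrm{Eval}_I(R)$ is the set of tuples obtained by the usual evaluation of $R$ on $I$. Suppose that for each expression $R$ with column sorts $s_1,\dots,s_n$ the signature contains a fact constructor $\mathcal R_R:s_1\dots s_n\to\mathsf{Fact}$, which is free: it is injective on values, terms $\mathcal R_R(\vec t)$ with fully reduced $\vec t$ are fully reduced, and for different relation symbols $r\ne r'$ of $\mathcal S$ the facts $\mathcal R_r(\vec t)$ and $\mathcal R_{r'}(\vec s)$ are different. Let $\mathrm{Trb}(I)$ be the multiset that contains $\mathcal R_r(\vec t)$ once for each relation symbol $r$ and each $\vec t\in r^I$. \textbf{Theorem.} For every relational algebra expression $R$ with column sorts $s_1,\dots,s_n$ there is a closed deterministic query $\mathrm{Tr}(R)$ in the query sublanguage such that for every relational database $I$ with schema $\mathcal S$ and every tuple $\vec t$ of values of sorts $s_1,\dots,s_n$, $$\exists F.\ \bigl(\mathrm{Init}_{\mathrm{Tr}(R)}(\mathrm{Trb}(I))\to^!\mathrm{Ans}(F\circ\mathcal R_R(\vec t))\bigr)\quad\text{iff}\quad \vec t\in\mathrm{Eval}_I(R).$$ -/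

import Mathlib

universe u v w

set_option linter.checkUnivs false

namespace QLang

/-! ## Order-sorted signatures and terms -/

/-- An order-sorted signature of facts. Function symbols are graded by their number of arguments,
and `rank f a s` says `f : a 0 ... a (n-1) → s`; a symbol may have several ranks, and the set of
ranks is covariant in the value and contravariant in the arguments.
The symbols that are not `visible` may occur in data, but not in queries (constructors of values of
nominal sorts are of this kind). -/
structure Signature where
  Srt : Type u
  [ord : PartialOrder Srt]
  Fn : ℕ → Type v
  rank : ∀ {n : ℕ}, Fn n → (Fin n → Srt) → Srt → Prop
  rank_mono : ∀ {n : ℕ} (f : Fn n) (a b : Fin n → Srt) (s t : Srt),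
    rank f a s → (∀ i, b i ≤ a i) → s ≤ t → rank f b t
  visible : ∀ {n : ℕ}, Fn n → Prop
  fact : Srt
  bool : Srt
  tt : Fn 0
  ff : Fn 0
  eq : Srt → Fn 2
  rank_tt : rank tt (fun _ => bool) bool
  rank_ff : rank ff (fun _ => bool) bool
  rank_eq : ∀ s, rank (eq s) (fun _ => s) bool
  visible_tt : visible tt
  visible_ff : visible ff
  visible_eq : ∀ s, visible (eq s)

attribute [instance] Signature.ord

/-- Variables: countably many of each sort. -/
structure Var (Sg : Signature.{u, v}) where
  sort : Sg.Srt
  idx : ℕ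

inductive Term (Sg : Signature.{u, v}) : Type (max u v) where
  | var (x : Var Sg) : Term Sg
  | app {n : ℕ} (f : Sg.Fn n) (ts : Fin n → Term Sg) : Term Sg

variable {Sg : Signature.{u, v}}

namespace Term

/-- The set of variables of a term. -/
def vars : Term Sg → Set (Var Sg)
  | var x => {x}
  | app _ ts => ⋃ i, (ts i).vars

def subst (σ : Var Sg → Term Sg) : Term Sg → Term Sg
  | var x => σ x
  | app f ts => app f fun i => (ts i).subst σ

/-- All function symbols of the term are allowed in queries. -/
def Visible : Term Sg → Prop
  | var _ => True
  | app f ts => Sg.visible f ∧ ∀ i, (ts i).Visible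

end Term

/-- `HasSort W t s`: the term `t` has variables in `W`, is sort-safe, and has sort `s`.
Ground terms of sort `s` are the terms with `HasSort ∅ t s`. -/
inductive HasSort (W : Set (Var Sg)) : Term Sg → Sg.Srt → Prop
  | var (x : Var Sg) (s : Sg.Srt) : x ∈ W → x.sort ≤ s → HasSort W (.var x) s
  | app {n : ℕ} (f : Sg.Fn n) (ts : Fin n → Term Sg) (a : Fin n → Sg.Srt) (s : Sg.Srt) :
      Sg.rank f a s → (∀ i, HasSort W (ts i) (a i)) → HasSort W (.app f ts) s

/-- `t` belongs to the set of sort-safe terms with variables in `W`. -/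
def WellSorted (W : Set (Var Sg)) (t : Term Sg) : Prop := ∃ s, HasSort W t s

/-- On the variables in `U`, the substitution `σ` takes values in sort-safe terms over `W`,
and respects sorts. -/
def SubstOn (W : Set (Var Sg)) (σ : Var Sg → Term Sg) (U : Set (Var Sg)) : Prop :=
  ∀ x ∈ U, HasSort W (σ x) x.sort

/-! ## Equational attributes, simplification, and the algebra of facts -/

/-- A conditional equality `lhs = rhs if C`, with `C` a conjunction of equalities. -/
structure CondEq (Sg : Signature.{u, v}) where
  lhs : Term Sg
  rhs : Term Sg
  conds : List (Term Sg × Term Sg)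

def CondEq.vars (e : CondEq Sg) : Set (Var Sg) :=
  {x | x ∈ e.lhs.vars ∨ x ∈ e.rhs.vars ∨ ∃ c ∈ e.conds, x ∈ c.1.vars ∨ x ∈ c.2.vars}

/-- Equational attributes `A` and directed conditional equalities `E`. -/
structure Presentation (Sg : Signature.{u, v}) where
  A : Set (Term Sg × Term Sg)
  E : Set (CondEq Sg)

namespace Presentation

variable (D : Presentation Sg)

/-- Equality modulo `A`: the congruence on sort-safe terms over `W` generated by `A`. -/
inductive EqA (W : Set (Var Sg)) : Term Sg → Term Sg → Prop
  | refl (t : Term Sg) : WellSorted W t → EqA W t t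
  | symm {t u : Term Sg} : EqA W t u → EqA W u t
  | trans {t u r : Term Sg} : EqA W t u → EqA W u r → EqA W t r
  | inst (e : Term Sg × Term Sg) (σ : Var Sg → Term Sg) : e ∈ D.A →
      SubstOn W σ (e.1.vars ∪ e.2.vars) →
      WellSorted W (e.1.subst σ) → WellSorted W (e.2.subst σ) →
      EqA W (e.1.subst σ) (e.2.subst σ)
  | cong {n : ℕ} (f : Sg.Fn n) (ts us : Fin n → Term Sg) :
      WellSorted W (.app f ts) → WellSorted W (.app f us) →
      (∀ i, EqA W (ts i) (us i)) → EqA W (.app f ts) (.app f us)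

/-- Equality modulo `A ∪ E`: the congruence on sort-safe terms over `W` generated by `A ∪ E`. -/
inductive EqAE (W : Set (Var Sg)) : Term Sg → Term Sg → Prop
  | refl (t : Term Sg) : WellSorted W t → EqAE W t t
  | symm {t u : Term Sg} : EqAE W t u → EqAE W u t
  | trans {t u r : Term Sg} : EqAE W t u → EqAE W u r → EqAE W t r
  | instA (e : Term Sg × Term Sg) (σ : Var Sg → Term Sg) : e ∈ D.A →
      SubstOn W σ (e.1.vars ∪ e.2.vars) →
      WellSorted W (e.1.subst σ) → WellSorted W (e.2.subst σ) →
      EqAE W (e.1.subst σ) (e.2.subst σ)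
  | instE (e : CondEq Sg) (σ : Var Sg → Term Sg) : e ∈ D.E → SubstOn W σ e.vars →
      WellSorted W (e.lhs.subst σ) → WellSorted W (e.rhs.subst σ) →
      (∀ c ∈ e.conds, EqAE W (c.1.subst σ) (c.2.subst σ)) →
      EqAE W (e.lhs.subst σ) (e.rhs.subst σ)
  | cong {n : ℕ} (f : Sg.Fn n) (ts us : Fin n → Term Sg) :
      WellSorted W (.app f ts) → WellSorted W (.app f us) →
      (∀ i, EqAE W (ts i) (us i)) → EqAE W (.app f ts) (.app f us)

/-- One simplification step modulo `A` on sort-safe terms over `W`: an instance of a directed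
equality of `E` with satisfied condition is applied to a subterm; subterms are taken modulo `A`. -/
inductive Simp (W : Set (Var Sg)) : Term Sg → Term Sg → Prop
  | top (e : CondEq Sg) (σ : Var Sg → Term Sg) : e ∈ D.E → SubstOn W σ e.vars →
      WellSorted W (e.lhs.subst σ) → WellSorted W (e.rhs.subst σ) →
      (∀ c ∈ e.conds, D.EqAE W (c.1.subst σ) (c.2.subst σ)) →
      Simp W (e.lhs.subst σ) (e.rhs.subst σ)
  | arg {n : ℕ} (f : Sg.Fn n) (ts : Fin n → Term Sg) (i : Fin n) (u : Term Sg) :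
      WellSorted W (.app f ts) → WellSorted W (.app f (Function.update ts i u)) →
      Simp W (ts i) u → Simp W (.app f ts) (.app f (Function.update ts i u))
  | modA {t t' u' u : Term Sg} : D.EqA W t t' → Simp W t' u' → D.EqA W u' u → Simp W t u

/-- Fully reduced sort-safe terms over `W`. -/
def Reduced (W : Set (Var Sg)) (t : Term Sg) : Prop :=
  WellSorted W t ∧ ¬ ∃ u, D.Simp W t u

/-- The standing assumptions on the presentation of the algebra of facts: simplification
terminates, is confluent modulo `A` on ground terms and does not lose sorts;
ground Boolean terms evaluate to exactly one of the two truth values; and `eq s` is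
Boolean-valued equality on the sort `s`. -/
structure IsFactAlgebra : Prop where
  terminating : WellFounded fun u t => D.Simp Set.univ t u
  confluent : ∀ t u u', Relation.ReflTransGen (D.Simp ∅) t u →
    Relation.ReflTransGen (D.Simp ∅) t u' → WellSorted ∅ t →
    ∃ r r', Relation.ReflTransGen (D.Simp ∅) u r ∧ Relation.ReflTransGen (D.Simp ∅) u' r' ∧
      D.EqA ∅ r r'
  sort_decreasing : ∀ W t u s, HasSort W t s → D.Simp W t u →
    ∃ u', D.EqA W u u' ∧ HasSort W u' s
  bool_cases : ∀ t, HasSort ∅ t Sg.bool →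
    D.EqAE ∅ t (.app Sg.tt ![]) ∨ D.EqAE ∅ t (.app Sg.ff ![])
  tt_ne_ff : ¬ D.EqAE ∅ (.app Sg.tt ![]) (.app Sg.ff ![])
  eq_iff : ∀ s t u, HasSort ∅ t s → HasSort ∅ u s →
    (D.EqAE ∅ (.app (Sg.eq s) ![t, u]) (.app Sg.tt ![]) ↔ D.EqAE ∅ t u)

/-- `A ∪ E`-equality of ground terms, extended by identity to the terms that are not sort-safe
or not ground (these play no role). -/
def valSetoid : Setoid (Term Sg) where
  r t u := t = u ∨ D.EqAE ∅ t u
  iseqv :=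
    { refl := fun _ => Or.inl rfl
      symm := by
        rintro t u (h | h)
        · exact Or.inl h.symm
        · exact Or.inr h.symm
      trans := by
        rintro t u r (rfl | h) (rfl | h')
        · exact Or.inl rfl
        · exact Or.inr h'
        · exact Or.inr h
        · exact Or.inr (h.trans h') }

/-- Values: classes of ground terms modulo `A ∪ E`. -/
def Val : Type (max u v) := Quotient D.valSetoid

def cls (t : Term Sg) : D.Val := Quotient.mk D.valSetoid t

/-- The set of values of sort `s` in the algebra of facts. -/
def carrier (s : Sg.Srt) : Set D.Val := {d | ∃ t, HasSort ∅ t s ∧ D.cls t = d}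

/-- A ground term of sort `s` that represents the value `d` (if `d` is of sort `s`). -/
noncomputable def rep (s : Sg.Srt) (d : D.Val) : Term Sg :=
  open Classical in
  if h : ∃ t, HasSort ∅ t s ∧ D.cls t = d then h.choose else Quotient.out d

/-- The value `f(d 0, ..., d (n-1))`, for `f` of rank `a 0 ... a (n-1) → s` and `d i` of
sort `a i`. -/
noncomputable def opVal {n : ℕ} (f : Sg.Fn n) (a : Fin n → Sg.Srt) (d : Fin n → D.Val) : D.Val :=
  D.cls (.app f fun i => D.rep (a i) (d i))

def ofBool : Bool → D.Val
  | true => D.cls (.app Sg.tt ![])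
  | false => D.cls (.app Sg.ff ![])

/-- `c` is a (free) constructor of facts with columns `a`: it is injective in the algebra of facts,
and no simplification takes place at the constructor itself. -/
structure IsFactConstructor {n : ℕ} (c : Sg.Fn n) (a : Fin n → Sg.Srt) : Prop where
  rank : Sg.rank c a Sg.fact
  visible : Sg.visible c
  injective : ∀ ts us : Fin n → Term Sg,
    (∀ i, HasSort ∅ (ts i) (a i)) → (∀ i, HasSort ∅ (us i) (a i)) →
    D.EqAE ∅ (.app c ts) (.app c us) → ∀ i, D.EqAE ∅ (ts i) (us i)
  reduced : ∀ (W : Set (Var Sg)) (ts : Fin n → Term Sg),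
    (∀ i, HasSort W (ts i) (a i)) → (∀ i, D.Reduced W (ts i)) → D.Reduced W (.app c ts)

/-- The facts built with the constructors `c` and `c'` are distinct. -/
def DisjointConstructors {n n' : ℕ} (c : Sg.Fn n) (a : Fin n → Sg.Srt)
    (c' : Sg.Fn n') (a' : Fin n' → Sg.Srt) : Prop :=
  ∀ ts us, (∀ i, HasSort ∅ (ts i) (a i)) → (∀ i, HasSort ∅ (us i) (a' i)) →
    ¬ D.EqAE ∅ (.app c ts) (.app c' us)

end Presentation

/-! ## Conditions and queries -/

/-- Terms of sort `s`, possibly with variables, that may occur in conditions and queries. -/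
def TermOf (Sg : Signature.{u, v}) (s : Sg.Srt) : Type (max u v) :=
  {t : Term Sg // HasSort Set.univ t s ∧ t.Visible}

/-- Terminating and preserving patterns `[keep]_! ∘ [ret]_?`, with at least one fact in `ret`. -/
structure Pattern (Sg : Signature.{u, v}) where
  keep : Multiset (TermOf Sg Sg.fact)
  ret : Multiset (TermOf Sg Sg.fact)
  ret_ne : ret ≠ 0

def Pattern.vars (P : Pattern Sg) : Set (Var Sg) :=
  {x | ∃ p ∈ P.keep + P.ret, x ∈ p.1.vars}

inductive Cond (Sg : Signature.{u, v}) : Type (max u v) where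
  | fls : Cond Sg
  | bool (B : TermOf Sg Sg.bool) : Cond Sg
  | neg (ψ : Cond Sg) : Cond Sg
  | or (ψ₁ ψ₂ : Cond Sg) : Cond Sg
  | ex (P : Pattern Sg) (ψ : Cond Sg) : Cond Sg

inductive Query (Sg : Signature.{u, v}) : Type (max u v) where
  | empty : Query Sg
  | fact (f : TermOf Sg Sg.fact) : Query Sg
  | union (Q₁ Q₂ : Query Sg) : Query Sg
  | cond (φ : Cond Sg) (Q : Query Sg) : Query Sg
  | from (P : Pattern Sg) (Q : Query Sg) : Query Sg

/-- Closedness of a condition in a context that binds the variables in `V`. -/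
def Cond.ClosedIn : Cond Sg → Set (Var Sg) → Prop
  | .fls, _ => True
  | .bool B, V => B.1.vars ⊆ V
  | .neg ψ, V => ψ.ClosedIn V
  | .or ψ₁ ψ₂, V => ψ₁.ClosedIn V ∧ ψ₂.ClosedIn V
  | .ex P ψ, V => ψ.ClosedIn (V ∪ P.vars)

/-- Closedness of a query in a context that binds the variables in `V`. -/
def Query.ClosedIn : Query Sg → Set (Var Sg) → Prop
  | .empty, _ => True
  | .fact f, V => f.1.vars ⊆ V
  | .union Q₁ Q₂, V => Q₁.ClosedIn V ∧ Q₂.ClosedIn V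
  | .cond φ Q, V => φ.ClosedIn V ∧ Q.ClosedIn V
  | .from P Q, V => Q.ClosedIn (V ∪ P.vars)

def Query.Closed (Q : Query Sg) : Prop := Q.ClosedIn ∅

namespace Presentation

variable (D : Presentation Sg)

/-- The unique matching property of a fully reduced fact term: it matches every fully reduced
ground fact modulo `A` by at most one substitution of its variables (up to `A`). -/
def UniqueMatching (f : Term Sg) : Prop :=
  D.Reduced Set.univ f ∧
  ∀ t, HasSort ∅ t Sg.fact → D.Reduced ∅ t →
    ∀ σ σ' : Var Sg → Term Sg, SubstOn ∅ σ f.vars → SubstOn ∅ σ' f.vars →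
      D.EqA ∅ (f.subst σ) t → D.EqA ∅ (f.subst σ') t →
      ∀ x ∈ f.vars, D.EqA ∅ (σ x) (σ' x)

/-- The pattern consists of a single fact, with the unique matching property. -/
def DetPattern (P : Pattern Sg) : Prop :=
  P.keep = 0 ∧ ∃ f, P.ret = {f} ∧ D.UniqueMatching f.1

def DetCond : Cond Sg → Prop
  | .fls => True
  | .bool _ => True
  | .neg ψ => DetCond ψ
  | .or ψ₁ ψ₂ => DetCond ψ₁ ∧ DetCond ψ₂
  | .ex P ψ => D.DetPattern P ∧ DetCond ψ

/-- Deterministic queries. -/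
def DetQuery : Query Sg → Prop
  | .empty => True
  | .fact _ => True
  | .union Q₁ Q₂ => DetQuery Q₁ ∧ DetQuery Q₂
  | .cond φ Q => D.DetCond φ ∧ DetQuery Q
  | .from P Q => D.DetPattern P ∧ DetQuery Q

/-! ## Rewriting semantics -/

/-- The current substitution of values for finitely many variables. -/
abbrev Env : Type (max u v) := Var Sg → Option D.Val

/-- `d` is the value of the term `t` under the substitution `ρ` (defined on all variables of
`t`). -/
def Denotes (ρ : D.Env) (t : Term Sg) (d : D.Val) : Prop :=
  ∃ σ : Var Sg → Term Sg, SubstOn ∅ σ t.vars ∧ (∀ x ∈ t.vars, ρ x = some (D.cls (σ x))) ∧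
    D.cls (t.subst σ) = d

/-- The iterator state `F` matches `G ∘ P_! ∘ P_?` by a substitution that extends `ρ`; then
`F' = G ∘ σ(P_!)` and `ρ'` is the extended substitution. Matching is modulo `A` on fully reduced
terms: the instances of the facts in the pattern have to be fully reduced. -/
def Match (P : Pattern Sg) (ρ : D.Env) (F F' : Multiset D.Val) (ρ' : D.Env) : Prop :=
  ∃ (σ : Var Sg → Term Sg) (G : Multiset D.Val),
    SubstOn ∅ σ P.vars ∧
    (∀ x ∈ P.vars, ∀ d, ρ x = some d → D.cls (σ x) = d) ∧
    (∀ p ∈ P.keep + P.ret, D.Reduced ∅ (p.1.subst σ)) ∧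
    F = G + P.keep.map (fun p => D.cls (p.1.subst σ)) +
      P.ret.map (fun p => D.cls (p.1.subst σ)) ∧
    F' = G + P.keep.map (fun p => D.cls (p.1.subst σ)) ∧
    (∀ x ∈ P.vars, ρ' x = some (D.cls (σ x))) ∧ (∀ x ∉ P.vars, ρ' x = ρ x)

/-- Frames of the stack for the evaluation of conditions. -/
inductive CFrame : Type (max u v) where
  | res (b : Bool) : CFrame
  | not : CFrame
  | eval (ρ : D.Env) (ψ : Cond Sg) : CFrame
  | down (ρ : D.Env) (ψ : Cond Sg) : CFrame
  | iter (F : Multiset D.Val) (ρ : D.Env) (P : Pattern Sg) (ψ : Cond Sg) : CFrame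

/-- Rewriting of the stack for conditions over the database `F`. The top of the stack is the head
of the list. -/
inductive CStep (F : Multiset D.Val) : List D.CFrame → List D.CFrame → Prop
  | fls (ρ : D.Env) (S : List D.CFrame) : CStep F (.eval ρ .fls :: S) (.res false :: S)
  | bool (ρ : D.Env) (B : TermOf Sg Sg.bool) (b : Bool) (S : List D.CFrame) :
      D.Denotes ρ B.1 (D.ofBool b) → CStep F (.eval ρ (.bool B) :: S) (.res b :: S)
  | neg_unfold (ρ : D.Env) (ψ : Cond Sg) (S : List D.CFrame) :
      CStep F (.eval ρ (.neg ψ) :: S) (.eval ρ ψ :: .not :: S)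
  | neg_fold (b : Bool) (S : List D.CFrame) :
      CStep F (.res b :: .not :: S) (.res (!b) :: S)
  | or_unfold (ρ : D.Env) (ψ₁ ψ₂ : Cond Sg) (S : List D.CFrame) :
      CStep F (.eval ρ (.or ψ₁ ψ₂) :: S) (.eval ρ ψ₂ :: .down ρ ψ₁ :: S)
  | or_fold_true (ρ : D.Env) (ψ : Cond Sg) (S : List D.CFrame) :
      CStep F (.res true :: .down ρ ψ :: S) (.res true :: S)
  | or_fold_false (ρ : D.Env) (ψ : Cond Sg) (S : List D.CFrame) :
      CStep F (.res false :: .down ρ ψ :: S) (.eval ρ ψ :: S)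
  | ex_init (ρ : D.Env) (P : Pattern Sg) (ψ : Cond Sg) (S : List D.CFrame) :
      CStep F (.eval ρ (.ex P ψ) :: S) (.iter F ρ P ψ :: S)
  | ex_unfold (F₁ F₂ : Multiset D.Val) (ρ ρ' : D.Env) (P : Pattern Sg) (ψ : Cond Sg)
      (S : List D.CFrame) : D.Match P ρ F₁ F₂ ρ' →
      CStep F (.iter F₁ ρ P ψ :: S) (.eval ρ' ψ :: .iter F₂ ρ P ψ :: S)
  | ex_fold_false (F₁ : Multiset D.Val) (ρ : D.Env) (P : Pattern Sg) (ψ : Cond Sg)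
      (S : List D.CFrame) :
      CStep F (.res false :: .iter F₁ ρ P ψ :: S) (.iter F₁ ρ P ψ :: S)
  | ex_fold_true (F₁ : Multiset D.Val) (ρ : D.Env) (P : Pattern Sg) (ψ : Cond Sg)
      (S : List D.CFrame) :
      CStep F (.res true :: .iter F₁ ρ P ψ :: S) (.res true :: S)
  | ex_end (F₁ : Multiset D.Val) (ρ : D.Env) (P : Pattern Sg) (ψ : Cond Sg)
      (S : List D.CFrame) : (¬ ∃ F₂ ρ', D.Match P ρ F₁ F₂ ρ') →
      CStep F (.iter F₁ ρ P ψ :: S) (.res false :: S)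

/-- Frames of the stack for the evaluation of queries. -/
inductive QFrame : Type (max u v) where
  | eval (ρ : D.Env) (R : Query Sg) : QFrame
  | cond (ρ : D.Env) (S : List D.CFrame) (R : Query Sg) : QFrame
  | iter (F : Multiset D.Val) (ρ : D.Env) (P : Pattern Sg) (R : Query Sg) : QFrame

/-- States: `run F F' S` with database `F`, partial answer `F'` and stack `S`, and the final
states `ans F'`. -/
inductive QState : Type (max u v) where
  | run (F F' : Multiset D.Val) (S : List D.QFrame) : QState
  | ans (F' : Multiset D.Val) : QState

/-- The rewriting system for queries. Frames carry the subquery they evaluate; from the initial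
state of a query `Q` only subqueries of `Q` (and subconditions of these) ever occur. -/
inductive QStep : D.QState → D.QState → Prop
  | fact (F F' : Multiset D.Val) (ρ : D.Env) (f : TermOf Sg Sg.fact) (d : D.Val)
      (S : List D.QFrame) : D.Denotes ρ f.1 d →
      QStep (.run F F' (.eval ρ (.fact f) :: S)) (.run F (F' + {d}) S)
  | empty (F F' : Multiset D.Val) (ρ : D.Env) (S : List D.QFrame) :
      QStep (.run F F' (.eval ρ .empty :: S)) (.run F F' S)
  | union (F F' : Multiset D.Val) (ρ : D.Env) (R₁ R₂ : Query Sg) (S : List D.QFrame) :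
      QStep (.run F F' (.eval ρ (.union R₁ R₂) :: S))
        (.run F F' (.eval ρ R₁ :: .eval ρ R₂ :: S))
  | cond_unfold (F F' : Multiset D.Val) (ρ : D.Env) (φ : Cond Sg) (R : Query Sg)
      (S : List D.QFrame) :
      QStep (.run F F' (.eval ρ (.cond φ R) :: S)) (.run F F' (.cond ρ [.eval ρ φ] R :: S))
  | cond_fold_false (F F' : Multiset D.Val) (ρ : D.Env) (R : Query Sg) (S : List D.QFrame) :
      QStep (.run F F' (.cond ρ [.res false] R :: S)) (.run F F' S)
  | cond_fold_true (F F' : Multiset D.Val) (ρ : D.Env) (R : Query Sg) (S : List D.QFrame) :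
      QStep (.run F F' (.cond ρ [.res true] R :: S)) (.run F F' (.eval ρ R :: S))
  | cond_step (F F' : Multiset D.Val) (ρ : D.Env) (S₁ S₂ : List D.CFrame) (R : Query Sg)
      (S : List D.QFrame) : D.CStep F S₁ S₂ →
      QStep (.run F F' (.cond ρ S₁ R :: S)) (.run F F' (.cond ρ S₂ R :: S))
  | from_init (F F' : Multiset D.Val) (ρ : D.Env) (P : Pattern Sg) (R : Query Sg)
      (S : List D.QFrame) :
      QStep (.run F F' (.eval ρ (.from P R) :: S)) (.run F F' (.iter F ρ P R :: S))
  | from_unfold (F F' F₁ F₂ : Multiset D.Val) (ρ ρ' : D.Env) (P : Pattern Sg) (R : Query Sg)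
      (S : List D.QFrame) : D.Match P ρ F₁ F₂ ρ' →
      QStep (.run F F' (.iter F₁ ρ P R :: S)) (.run F F' (.eval ρ' R :: .iter F₂ ρ P R :: S))
  | from_end (F F' F₁ : Multiset D.Val) (ρ : D.Env) (P : Pattern Sg) (R : Query Sg)
      (S : List D.QFrame) : (¬ ∃ F₂ ρ', D.Match P ρ F₁ F₂ ρ') →
      QStep (.run F F' (.iter F₁ ρ P R :: S)) (.run F F' S)
  | ans (F F' : Multiset D.Val) : QStep (.run F F' []) (.ans F')

/-- The initial state for the evaluation of `Q` against `F`. -/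
def init (Q : Query Sg) (F : Multiset D.Val) : D.QState :=
  .run F 0 [.eval (fun _ => none) Q]

/-- `X` can be rewritten to the normal form `Y`. -/
def Normalizes (X Y : D.QState) : Prop :=
  Relation.ReflTransGen D.QStep X Y ∧ ¬ ∃ Z, D.QStep Y Z

end Presentation

/-! ## Relational databases and relational algebra -/

/-- A relational schema: finitely many relation symbols, with sorted columns. -/
structure Schema (Sg : Signature.{u, v}) where
  Rel : Type w
  [fin : Fintype Rel]
  arity : Rel → ℕ
  cols : ∀ r : Rel, Fin (arity r) → Sg.Srt

attribute [instance] Schema.fin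

/-- The special variable that stands for the `i`-th column of a row with columns `a`. -/
def colVar {n : ℕ} (a : Fin n → Sg.Srt) (i : Fin n) : Var Sg := ⟨a i, i⟩

/-- Selection conditions on rows with columns `a`: terms of sort `bool` in the column variables. -/
def RowCond {n : ℕ} (a : Fin n → Sg.Srt) : Type (max u v) :=
  {φ : Term Sg // HasSort (Set.range (colVar a)) φ Sg.bool ∧ φ.Visible}

/-- Relational algebra expressions whose values have columns `a`. -/
inductive RelExpr (𝒮 : Schema.{u, v, w} Sg) :
    {n : ℕ} → (Fin n → Sg.Srt) → Type (max u v w) where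
  | base (r : 𝒮.Rel) : RelExpr 𝒮 (𝒮.cols r)
  | proj {n k : ℕ} {a : Fin n → Sg.Srt} (i : Fin k → Fin n) (R : RelExpr 𝒮 a) :
      RelExpr 𝒮 (a ∘ i)
  | sel {n : ℕ} {a : Fin n → Sg.Srt} (φ : RowCond a) (R : RelExpr 𝒮 a) : RelExpr 𝒮 a
  | union {n : ℕ} {a : Fin n → Sg.Srt} (R S : RelExpr 𝒮 a) : RelExpr 𝒮 a
  | prod {n m : ℕ} {a : Fin n → Sg.Srt} {b : Fin m → Sg.Srt} (R : RelExpr 𝒮 a)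
      (S : RelExpr 𝒮 b) : RelExpr 𝒮 (Fin.append a b)
  | diff {n : ℕ} {a : Fin n → Sg.Srt} (R S : RelExpr 𝒮 a) : RelExpr 𝒮 a

/-- A relational database: a finite relation on values of the right sorts for each symbol. -/
structure Database (D : Presentation Sg) (𝒮 : Schema.{u, v, w} Sg) where
  rel : ∀ r : 𝒮.Rel, Set (Fin (𝒮.arity r) → D.Val)
  finite : ∀ r, (rel r).Finite
  sorted : ∀ r, ∀ t ∈ rel r, ∀ i, t i ∈ D.carrier (𝒮.cols r i)

/-- The row `t` with columns `a` satisfies the selection condition `φ`. -/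
def RowCond.Holds (D : Presentation Sg) {n : ℕ} {a : Fin n → Sg.Srt} (φ : RowCond a)
    (t : Fin n → D.Val) : Prop :=
  ∃ σ : Var Sg → Term Sg, SubstOn ∅ σ (Set.range (colVar a)) ∧
    (∀ i, D.cls (σ (colVar a i)) = t i) ∧ D.cls (φ.1.subst σ) = D.ofBool true

/-- Evaluation of relational algebra expressions. -/
def RelExpr.eval {D : Presentation Sg} {𝒮 : Schema.{u, v, w} Sg} (I : Database D 𝒮) :
    ∀ {n : ℕ} {a : Fin n → Sg.Srt}, RelExpr 𝒮 a → Set (Fin n → D.Val)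
  | _, _, .base r => I.rel r
  | _, _, .proj i R => {t | ∃ s ∈ R.eval I, t = s ∘ i}
  | _, _, .sel φ R => {t | t ∈ R.eval I ∧ φ.Holds D t}
  | _, _, .union R S => R.eval I ∪ S.eval I
  | _, _, .prod R S => {t | ∃ r ∈ R.eval I, ∃ s ∈ S.eval I, t = Fin.append r s}
  | _, _, .diff R S => R.eval I \ S.eval I

/-- The multiset of facts that corresponds to the database `I`, where `sym r` is the constructor
of facts for the relation symbol `r`. -/
noncomputable def Database.toFacts {D : Presentation Sg} {𝒮 : Schema.{u, v, w} Sg}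
    (I : Database D 𝒮) (sym : ∀ r : 𝒮.Rel, Sg.Fn (𝒮.arity r)) : Multiset D.Val :=
  ∑ r : 𝒮.Rel, (I.finite r).toFinset.val.map fun t => D.opVal (sym r) (𝒮.cols r) t

end QLang

/-! The translation is in continuation-passing style. A relational expression becomes a nest of
iterations that binds variables to the columns of one of its rows; a continuation says what to do
with these variables. A relation symbol becomes one iteration over its facts, a product becomes
nested iterations, a projection reindexes variables, a union duplicates the continuation, and a
selection guards it. A difference guards it by the negation of an existential condition that
searches the second expression for an equal row; hence a parallel translation into conditions
(`RelExpr.toCond`). The outermost continuation outputs the fact of the row. No intermediate relation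
is stored, and every iteration starts from the whole database.

Rewriting is nondeterministic because matches may be taken in any order. The invariant is therefore
that every maximal run reaches the expected result (`Inevitable`). Answers are compared only by
their sets of facts, since projections and unions produce duplicates. An iteration ends because each
match removes one fact. It visits exactly the rows of the relation because matches of a constructor
applied to fresh variables correspond to facts of that relation (`match_rowPattern_iff`), by
freeness and disjointness of the constructors. `RelExpr.cEvals_toCond` and `RelExpr.qEvals_toQuery`
combine this by induction on the expression.

Determinism of the patterns needs term rewriting: injectivity of constructors holds modulo `A ∪ E`,
but unique matching is required modulo `A`. The Church-Rosser property closes the gap for fully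
reduced terms. -/

namespace QLang

variable {Sg : Signature.{u, v}}

/-! ## Substitution -/

namespace Term

theorem subst_subst (σ θ : Var Sg → Term Sg) (t : Term Sg) :
    (t.subst σ).subst θ = t.subst fun x => (σ x).subst θ := by
  induction t with
  | var x => rfl
  | app f ts ih => simp only [subst, ih]

theorem subst_var (t : Term Sg) : t.subst Term.var = t := by
  induction t with
  | var x => rfl
  | app f ts ih => simp only [subst, ih]

theorem Visible.subst {σ : Var Sg → Term Sg} (hσ : ∀ x, (σ x).Visible) {t : Term Sg}
    (h : t.Visible) : (t.subst σ).Visible := by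
  induction t with
  | var x => exact hσ x
  | app f ts ih => exact ⟨h.1, fun i => ih i (h.2 i)⟩

end Term

/-! ### Sort-safety and substitution -/

namespace HasSort

variable {W W' : Set (Var Sg)} {t : Term Sg} {s s' : Sg.Srt}

theorem le (h : HasSort W t s) (hs : s ≤ s') : HasSort W t s' := by
  cases h with
  | var x _ hx hxs => exact .var x s' hx (hxs.trans hs)
  | app f ts a _ hr hts => exact .app f ts a s' (Sg.rank_mono f a a s s' hr (fun _ => le_rfl) hs) hts

theorem subst_of_vars {σ : Var Sg → Term Sg} (h : HasSort W t s) (hσ : SubstOn W' σ t.vars) :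
    HasSort W' (t.subst σ) s := by
  induction h with
  | var x s hx hxs => exact (hσ x rfl).le hxs
  | app f ts a s hr _ ih =>
    exact .app f _ a s hr fun i => ih i fun x hx => hσ x (Set.mem_iUnion.2 ⟨i, hx⟩)

theorem vars_subset (h : HasSort W t s) : t.vars ⊆ W := by
  induction h with
  | var x s hx hxs => simpa [Term.vars] using hx
  | app f ts a s hr _ ih => exact Set.iUnion_subset ih

theorem subst {σ : Var Sg → Term Sg} (h : HasSort W t s) (hσ : SubstOn W' σ W) :
    HasSort W' (t.subst σ) s :=
  h.subst_of_vars fun x hx => hσ x (h.vars_subset hx)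

theorem wellSorted (h : HasSort W t s) : WellSorted W t := ⟨s, h⟩

end HasSort

theorem WellSorted.subst {W W' : Set (Var Sg)} {t : Term Sg} {σ : Var Sg → Term Sg}
    (h : WellSorted W t) (hσ : SubstOn W' σ W) : WellSorted W' (t.subst σ) :=
  h.imp fun _ hs => hs.subst hσ

theorem WellSorted.arg {W : Set (Var Sg)} {n : ℕ} {f : Sg.Fn n} {ts : Fin n → Term Sg}
    (h : WellSorted W (.app f ts)) (i : Fin n) : WellSorted W (ts i) := by
  obtain ⟨s, hs⟩ := h
  cases hs with
  | app f ts a s hr hts => exact ⟨a i, hts i⟩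

theorem SubstOn.comp {W W' U : Set (Var Sg)} {σ θ : Var Sg → Term Sg} (hσ : SubstOn W σ U)
    (hθ : SubstOn W' θ W) : SubstOn W' (fun x => (σ x).subst θ) U :=
  fun x hx => (hσ x hx).subst hθ

theorem substOn_var {W W' : Set (Var Sg)} (h : W ⊆ W') : SubstOn W' Term.var W :=
  fun x hx => .var x _ (h hx) le_rfl

/-! ### Stability of equality and simplification under substitution -/

namespace Presentation

variable {D : Presentation Sg} {W W' : Set (Var Sg)}

theorem EqA.wellSorted {t u : Term Sg} (h : D.EqA W t u) : WellSorted W t ∧ WellSorted W u := by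
  induction h with
  | refl t h => exact ⟨h, h⟩
  | symm _ ih => exact ih.symm
  | trans _ _ ih ih' => exact ⟨ih.1, ih'.2⟩
  | inst e σ _ _ h h' => exact ⟨h, h'⟩
  | cong f ts us h h' => exact ⟨h, h'⟩

theorem EqAE.wellSorted {t u : Term Sg} (h : D.EqAE W t u) :
    WellSorted W t ∧ WellSorted W u := by
  induction h with
  | refl t h => exact ⟨h, h⟩
  | symm _ ih => exact ih.symm
  | trans _ _ ih ih' => exact ⟨ih.1, ih'.2⟩
  | instA e σ _ _ h h' => exact ⟨h, h'⟩
  | instE e σ _ _ h h' => exact ⟨h, h'⟩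
  | cong f ts us h h' => exact ⟨h, h'⟩

theorem Simp.wellSorted {t u : Term Sg} (h : D.Simp W t u) : WellSorted W t ∧ WellSorted W u := by
  induction h with
  | top e σ _ _ h h' => exact ⟨h, h'⟩
  | arg f ts i u h h' => exact ⟨h, h'⟩
  | modA h _ h' => exact ⟨h.wellSorted.1, h'.wellSorted.2⟩

theorem EqA.eqAE {t u : Term Sg} (h : D.EqA W t u) : D.EqAE W t u := by
  induction h with
  | refl t h => exact .refl t h
  | symm _ ih => exact ih.symm
  | trans _ _ ih ih' => exact ih.trans ih'
  | inst e σ he hσ h h' => exact .instA e σ he hσ h h'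
  | cong f ts us h h' _ ih => exact .cong f ts us h h' ih

theorem Simp.eqAE {t u : Term Sg} (h : D.Simp W t u) : D.EqAE W t u := by
  induction h with
  | top e σ he hσ h h' hc => exact .instE e σ he hσ h h' hc
  | arg f ts i u h h' _ ih =>
    refine .cong f _ _ h h' fun j => ?_
    by_cases hj : j = i
    · subst hj
      simpa using ih
    · rw [Function.update_of_ne hj]
      exact .refl _ (h.arg j)
  | modA h _ h' ih => exact (h.eqAE.trans ih).trans h'.eqAE

theorem EqA.subst {θ : Var Sg → Term Sg} (hθ : SubstOn W' θ W) {t u : Term Sg}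
    (h : D.EqA W t u) : D.EqA W' (t.subst θ) (u.subst θ) := by
  induction h with
  | refl t h => exact .refl _ (h.subst hθ)
  | symm _ ih => exact ih.symm
  | trans _ _ ih ih' => exact ih.trans ih'
  | inst e σ he hσ h h' =>
    have h := h.subst hθ
    have h' := h'.subst hθ
    rw [Term.subst_subst] at h h' ⊢
    rw [Term.subst_subst]
    exact .inst e _ he (hσ.comp hθ) h h'
  | cong f ts us h h' _ ih => exact .cong f _ _ (h.subst hθ) (h'.subst hθ) ih

theorem EqAE.subst {θ : Var Sg → Term Sg} (hθ : SubstOn W' θ W) {t u : Term Sg}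
    (h : D.EqAE W t u) : D.EqAE W' (t.subst θ) (u.subst θ) := by
  induction h with
  | refl t h => exact .refl _ (h.subst hθ)
  | symm _ ih => exact ih.symm
  | trans _ _ ih ih' => exact ih.trans ih'
  | instA e σ he hσ h h' =>
    have h := h.subst hθ
    have h' := h'.subst hθ
    rw [Term.subst_subst] at h h' ⊢
    rw [Term.subst_subst]
    exact .instA e _ he (hσ.comp hθ) h h'
  | instE e σ he hσ h h' _ ih =>
    have h := h.subst hθ
    have h' := h'.subst hθ
    simp only [Term.subst_subst] at h h' ih ⊢
    exact .instE e _ he (hσ.comp hθ) h h' ih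
  | cong f ts us h h' _ ih => exact .cong f _ _ (h.subst hθ) (h'.subst hθ) ih

theorem Simp.subst {θ : Var Sg → Term Sg} (hθ : SubstOn W' θ W) {t u : Term Sg}
    (h : D.Simp W t u) : D.Simp W' (t.subst θ) (u.subst θ) := by
  induction h with
  | top e σ he hσ h h' hc =>
    have h := h.subst hθ
    have h' := h'.subst hθ
    have hc' := fun c hcm => (hc c hcm).subst hθ
    simp only [Term.subst_subst] at h h' hc' ⊢
    exact .top e _ he (hσ.comp hθ) h h' hc'
  | arg f ts i u h h' _ ih =>
    have key : (Term.app f (Function.update ts i u)).subst θ =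
        .app f (Function.update (fun j => (ts j).subst θ) i (u.subst θ)) := by
      simp only [Term.subst]
      congr 1
      funext j
      by_cases hj : j = i
      · subst hj; simp
      · simp [Function.update_of_ne hj]
    have h' := h'.subst hθ
    rw [key] at h' ⊢
    exact .arg f _ i _ (h.subst hθ) h' ih
  | modA h _ h' ih => exact .modA (h.subst hθ) ih (h'.subst hθ)

/-- Termination is assumed for terms with arbitrary variables; this inclusion makes it available for
ground simplification. -/
theorem Simp.mono (hW : W ⊆ W') {t u : Term Sg} (h : D.Simp W t u) : D.Simp W' t u := by
  simpa only [Term.subst_var] using h.subst (substOn_var hW)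

/-- Instances of a term under substitutions that are equal modulo `A ∪ E` are equal
modulo `A ∪ E`. -/
theorem eqAE_subst_of_eqAE {t : Term Sg} {s : Sg.Srt} (ht : HasSort W t s)
    {σ θ : Var Sg → Term Sg} (hσ : SubstOn W' σ t.vars) (hθ : SubstOn W' θ t.vars)
    (h : ∀ x ∈ t.vars, D.EqAE W' (σ x) (θ x)) : D.EqAE W' (t.subst σ) (t.subst θ) := by
  induction ht with
  | var x s hx hxs => exact h x rfl
  | app f ts a s hr hts ih =>
    have hv : ∀ i, ∀ x ∈ (ts i).vars, x ∈ (Term.app f ts).vars :=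
      fun i x hx => Set.mem_iUnion.2 ⟨i, hx⟩
    have h0 : HasSort W (.app f ts) s := .app f ts a s hr hts
    exact .cong f _ _ (h0.subst_of_vars hσ).wellSorted (h0.subst_of_vars hθ).wellSorted
      fun i => ih i (fun x hx => hσ x (hv i x hx)) (fun x hx => hθ x (hv i x hx))
        fun x hx => h x (hv i x hx)

/-! ## Values -/

/-- Sort-safety of `t` is needed because `valSetoid` also relates identical terms that are not
sort-safe, to which reflexivity of `EqAE` does not apply. -/
theorem cls_eq_iff {t u : Term Sg} (ht : WellSorted ∅ t) : D.cls t = D.cls u ↔ D.EqAE ∅ t u := by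
  refine ⟨fun h => ?_, fun h => Quotient.sound (Or.inr h)⟩
  rcases (Quotient.exact h : t = u ∨ D.EqAE ∅ t u) with rfl | h
  · exact .refl _ ht
  · exact h

theorem hasSort_rep {s : Sg.Srt} {d : D.Val} (h : d ∈ D.carrier s) : HasSort ∅ (D.rep s d) s := by
  have h' : ∃ t, HasSort ∅ t s ∧ D.cls t = d := h
  rw [rep, dif_pos h']
  exact h'.choose_spec.1

theorem cls_rep {s : Sg.Srt} {d : D.Val} (h : d ∈ D.carrier s) : D.cls (D.rep s d) = d := by
  have h' : ∃ t, HasSort ∅ t s ∧ D.cls t = d := h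
  rw [rep, dif_pos h']
  exact h'.choose_spec.2

/-! ### Constructors acting on values -/

namespace IsFactConstructor

variable {n : ℕ} {c : Sg.Fn n} {a : Fin n → Sg.Srt}

theorem hasSort (hc : D.IsFactConstructor c a) {ts : Fin n → Term Sg}
    (h : ∀ i, HasSort W (ts i) (a i)) : HasSort W (.app c ts) Sg.fact :=
  .app c ts a _ hc.rank h

/-- By congruence, the representatives chosen in `opVal` do not matter. -/
theorem opVal_eq_cls (hc : D.IsFactConstructor c a) {ts : Fin n → Term Sg}
    (h : ∀ i, HasSort ∅ (ts i) (a i)) :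
    D.opVal c a (fun i => D.cls (ts i)) = D.cls (.app c ts) := by
  have hcar : ∀ i, D.cls (ts i) ∈ D.carrier (a i) := fun i => ⟨ts i, h i, rfl⟩
  have hrep := fun i => hasSort_rep (hcar i)
  refine (cls_eq_iff (hc.hasSort hrep).wellSorted).2 ?_
  exact .cong c _ _ (hc.hasSort hrep).wellSorted (hc.hasSort h).wellSorted
    fun i => (cls_eq_iff (hrep i).wellSorted).1 (cls_rep (hcar i))

theorem opVal_inj (hc : D.IsFactConstructor c a) {d e : Fin n → D.Val}
    (hd : ∀ i, d i ∈ D.carrier (a i)) (he : ∀ i, e i ∈ D.carrier (a i))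
    (h : D.opVal c a d = D.opVal c a e) : d = e := by
  have hd' := fun i => hasSort_rep (hd i)
  have he' := fun i => hasSort_rep (he i)
  have := hc.injective _ _ hd' he' ((cls_eq_iff (hc.hasSort hd').wellSorted).1 h)
  funext i
  rw [← cls_rep (hd i), ← cls_rep (he i)]
  exact (cls_eq_iff (hd' i).wellSorted).2 (this i)

end IsFactConstructor

theorem DisjointConstructors.opVal_ne {n n' : ℕ} {c : Sg.Fn n} {a : Fin n → Sg.Srt}
    {c' : Sg.Fn n'} {a' : Fin n' → Sg.Srt} (hc : D.IsFactConstructor c a)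
    (h : D.DisjointConstructors c a c' a') {d : Fin n → D.Val} {e : Fin n' → D.Val}
    (hd : ∀ i, d i ∈ D.carrier (a i)) (he : ∀ i, e i ∈ D.carrier (a' i)) :
    D.opVal c a d ≠ D.opVal c' a' e := fun heq =>
  have hd' := fun i => hasSort_rep (hd i)
  h _ _ hd' (fun i => hasSort_rep (he i)) ((cls_eq_iff (hc.hasSort hd').wellSorted).1 heq)

/-! ## Normal forms -/

/-- A simplification step absorbs an `A`-equality at its start, so a nonempty sequence can begin at
`t` and keep its endpoint. Only for the empty sequence does the `A`-equality remain. -/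
theorem reflTransGen_simp_of_eqA {t t' u : Term Sg} (h : D.EqA W t t')
    (h' : Relation.ReflTransGen (D.Simp W) t' u) :
    ∃ u', Relation.ReflTransGen (D.Simp W) t u' ∧ D.EqA W u' u := by
  rcases h'.cases_head with rfl | ⟨r, hr, hru⟩
  · exact ⟨t, .refl, h⟩
  · have hu : D.EqA W r r := .refl _ hr.wellSorted.2
    exact ⟨u, .head (.modA h hr hu) hru,
      .refl _ (hru.cases_tail.elim (fun e => e ▸ hr.wellSorted.2)
        fun ⟨_, _, hs⟩ => hs.wellSorted.2)⟩

theorem Reduced.eqA {t u : Term Sg} (ht : D.Reduced W t) (h : D.EqA W t u) : D.Reduced W u :=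
  ⟨h.wellSorted.2, fun ⟨r, hr⟩ => ht.2 ⟨r, .modA h hr (.refl _ hr.wellSorted.2)⟩⟩

theorem Reduced.eq_of_reflTransGen {t u : Term Sg} (ht : D.Reduced W t)
    (h : Relation.ReflTransGen (D.Simp W) t u) : t = u := by
  rcases h.cases_head with h | ⟨r, hr, _⟩
  · exact h
  · exact (ht.2 ⟨r, hr⟩).elim

/-! ### Reduced terms and the Church-Rosser property -/

namespace IsFactAlgebra

variable (hD : D.IsFactAlgebra)
include hD

/-- The result of a step may have the sort only after a change within its `A`-class; that change is
made part of the step. -/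
theorem exists_simp_hasSort {t u : Term Sg} {s : Sg.Srt} (ht : HasSort W t s)
    (h : D.Simp W t u) : ∃ u', D.EqA W u u' ∧ D.Simp W t u' ∧ HasSort W u' s := by
  obtain ⟨u', he, hs⟩ := hD.sort_decreasing W t u s ht h
  exact ⟨u', he, .modA (.refl _ ht.wellSorted) h he, hs⟩

theorem exists_reduced (t : Term Sg) : ∀ s, HasSort ∅ t s →
    ∃ u, HasSort ∅ u s ∧ D.Reduced ∅ u ∧ D.EqAE ∅ t u := by
  induction t using hD.terminating.induction with
  | _ t ih =>
    intro s hs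
    by_cases h : ∃ u, D.Simp ∅ t u
    · obtain ⟨u, hu⟩ := h
      obtain ⟨u', -, hu', hs'⟩ := hD.exists_simp_hasSort hs hu
      obtain ⟨r, h1, h2, h3⟩ := ih u' (hu'.mono (Set.empty_subset _)) s hs'
      exact ⟨r, h1, h2, hu'.eqAE.trans h3⟩
    · exact ⟨t, hs, ⟨hs.wellSorted, h⟩, .refl _ hs.wellSorted⟩

theorem exists_reduced_of_mem_carrier {s : Sg.Srt} {d : D.Val} (h : d ∈ D.carrier s) :
    ∃ u, HasSort ∅ u s ∧ D.Reduced ∅ u ∧ D.cls u = d := by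
  obtain ⟨t, ht, rfl⟩ := h
  obtain ⟨u, h1, h2, h3⟩ := hD.exists_reduced t s ht
  exact ⟨u, h1, h2, (cls_eq_iff h1.wellSorted).2 h3.symm⟩

/-- Simplification of an argument, without loss of sorts. -/
theorem reflTransGen_simp_update {n : ℕ} (f : Sg.Fn n) {a : Fin n → Sg.Srt} {s : Sg.Srt}
    (hf : Sg.rank f a s) (i : Fin n) {u : Term Sg} {ts : Fin n → Term Sg}
    (hts : ∀ j, HasSort W (ts j) (a j)) (h : Relation.ReflTransGen (D.Simp W) (ts i) u) :
    ∃ u', D.EqA W u u' ∧ HasSort W u' (a i) ∧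
      Relation.ReflTransGen (D.Simp W) (.app f ts) (.app f (Function.update ts i u')) := by
  induction h with
  | refl => exact ⟨ts i, .refl _ (hts i).wellSorted, hts i, by simp [Relation.ReflTransGen.refl]⟩
  | @tail u r _ hur ih =>
    obtain ⟨u', he, hs, hsteps⟩ := ih
    obtain ⟨r', he', hr', hsr⟩ := hD.exists_simp_hasSort hs
      (.modA he.symm hur (.refl _ hur.wellSorted.2))
    have hws : ∀ q, HasSort W q (a i) → ∀ j, HasSort W (Function.update ts i q j) (a j) := by
      intro q hq j
      by_cases hj : j = i
      · subst hj; simpa using hq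
      · simpa [Function.update_of_ne hj] using hts j
    refine ⟨r', he', hsr, hsteps.tail ?_⟩
    have := Simp.arg (D := D) (W := W) f (Function.update ts i u') i r'
      (HasSort.app f _ a s hf (hws u' hs)).wellSorted
      (by
        rw [Function.update_idem]
        exact (HasSort.app f _ a s hf (hws r' hsr)).wellSorted)
      (by simpa using hr')
    rwa [Function.update_idem] at this

theorem reflTransGen_simp_app {n : ℕ} (f : Sg.Fn n) {ts us : Fin n → Term Sg}
    (hts : WellSorted W (.app f ts))
    (h : ∀ i, Relation.ReflTransGen (D.Simp W) (ts i) (us i)) :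
    ∃ us', (∀ i, D.EqA W (us i) (us' i)) ∧ WellSorted W (.app f us') ∧
      Relation.ReflTransGen (D.Simp W) (.app f ts) (.app f us') := by
  obtain ⟨s, hs⟩ := hts
  cases hs with
  | app f ts a s hf hts =>
    -- The arguments are simplified one at a time; `A` collects those already done. They are reached
    -- only modulo `A`-equality because each may need a sort-preserving replacement.
    suffices H : ∀ A : Finset (Fin n), ∃ us' : Fin n → Term Sg, (∀ i ∈ A, D.EqA W (us i) (us' i)) ∧
        (∀ i ∉ A, us' i = ts i) ∧ (∀ i, HasSort W (us' i) (a i)) ∧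
        Relation.ReflTransGen (D.Simp W) (.app f ts) (.app f us') by
      obtain ⟨us', h1, -, h3, h4⟩ := H Finset.univ
      exact ⟨us', fun i => h1 i (Finset.mem_univ i), ⟨s, .app f _ a s hf h3⟩, h4⟩
    intro A
    induction A using Finset.induction_on with
    | empty => exact ⟨ts, by simp, by simp, hts, .refl⟩
    | insert i A hi ih =>
      obtain ⟨us', h1, h2, h3, h4⟩ := ih
      obtain ⟨u, he, hu, hsteps⟩ := hD.reflTransGen_simp_update f hf i h3
        (u := us i) (by rw [h2 i hi]; exact h i)
      refine ⟨Function.update us' i u, fun j hj => ?_, fun j hj => ?_, fun j => ?_,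
        h4.trans hsteps⟩
      · by_cases hji : j = i
        · subst hji; simpa using he
        · rw [Function.update_of_ne hji]
          exact h1 j ((Finset.mem_insert.1 hj).resolve_left hji)
      · rw [Finset.mem_insert, not_or] at hj
        rw [Function.update_of_ne hj.1]
        exact h2 j hj.2
      · by_cases hji : j = i
        · subst hji; simpa using hu
        · rw [Function.update_of_ne hji]
          exact h3 j

/-- The Church-Rosser property modulo `A` on ground terms. -/
theorem church_rosser {t u : Term Sg} (h : D.EqAE ∅ t u) :
    ∃ r r', Relation.ReflTransGen (D.Simp ∅) t r ∧ Relation.ReflTransGen (D.Simp ∅) u r' ∧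
      D.EqA ∅ r r' := by
  induction h with
  | refl t h => exact ⟨t, t, .refl, .refl, .refl _ h⟩
  | symm _ ih =>
    obtain ⟨r, r', h1, h2, h3⟩ := ih
    exact ⟨r', r, h2, h1, h3.symm⟩
  | trans h _ ih ih' =>
    obtain ⟨r, r', h1, h2, h3⟩ := ih
    obtain ⟨q, q', h1', h2', h3'⟩ := ih'
    -- Confluence applies at the common middle term, which simplifies both to `r'` and to `q`. The
    -- two continuations are then pulled back along the `A`-equalities to `r` and `q'`.
    obtain ⟨p, p', hp, hp', he⟩ := hD.confluent _ _ _ h2 h1' h.wellSorted.2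
    obtain ⟨x, hx, hxe⟩ := reflTransGen_simp_of_eqA h3 hp
    obtain ⟨y, hy, hye⟩ := reflTransGen_simp_of_eqA h3'.symm hp'
    exact ⟨x, y, h1.trans hx, h2'.trans hy, (hxe.trans he).trans hye.symm⟩
  | instA e σ he hσ h h' => exact ⟨_, _, .refl, .refl, .inst e σ he hσ h h'⟩
  | instE e σ he hσ h h' hc _ =>
    exact ⟨_, _, .single (.top e σ he hσ h h' hc), .refl, .refl _ h'⟩
  | cong f ts us h h' _ ih =>
    choose r r' h1 h2 h3 using ih
    obtain ⟨q, hq, hw, hs⟩ := hD.reflTransGen_simp_app f h h1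
    obtain ⟨q', hq', hw', hs'⟩ := hD.reflTransGen_simp_app f h' h2
    exact ⟨_, _, hs, hs', .cong f _ _ hw hw' fun i => ((hq i).symm.trans (h3 i)).trans (hq' i)⟩

/-- The joining sequences from the Church-Rosser property are empty at reduced terms, so only their
`A`-equality remains. -/
theorem eqA_of_eqAE_of_reduced {t u : Term Sg} (ht : D.Reduced ∅ t) (hu : D.Reduced ∅ u)
    (h : D.EqAE ∅ t u) : D.EqA ∅ t u := by
  obtain ⟨r, r', h1, h2, h3⟩ := hD.church_rosser h
  rwa [← ht.eq_of_reflTransGen h1, ← hu.eq_of_reflTransGen h2] at h3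

/-- A step in an argument lifts to the whole term once its result is replaced by one of the required
sort, which keeps the whole term sort-safe. -/
theorem reduced_arg {n : ℕ} {f : Sg.Fn n} {ts : Fin n → Term Sg} (h : D.Reduced W (.app f ts))
    (i : Fin n) : D.Reduced W (ts i) := by
  refine ⟨h.1.arg i, fun ⟨u, hu⟩ => h.2 ?_⟩
  obtain ⟨s, hs⟩ := h.1
  cases hs with
  | app f ts a s hf hts =>
    obtain ⟨u', -, hu', hs'⟩ := hD.exists_simp_hasSort (hts i) hu
    refine ⟨_, .arg f ts i u' ⟨s, .app f ts a s hf hts⟩ ⟨s, .app f _ a s hf fun j => ?_⟩ hu'⟩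
    by_cases hj : j = i
    · subst hj; simpa using hs'
    · simpa [Function.update_of_ne hj] using hts j

/-- A variable cannot be simplified: otherwise, substitution gives an infinite simplification. -/
theorem reduced_var (x : Var Sg) : D.Reduced Set.univ (.var x) := by
  have hx : HasSort Set.univ (.var x) x.sort := .var x _ trivial le_rfl
  refine ⟨hx.wellSorted, fun ⟨u, hu⟩ => ?_⟩
  obtain ⟨u', -, hu', hs⟩ := hD.exists_simp_hasSort hx hu
  classical
  let θ : Var Sg → Term Sg := Function.update Term.var x u'
  have hθ : SubstOn Set.univ θ Set.univ := by
    intro y _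
    by_cases hy : y = x
    · subst hy; simpa [θ] using hs
    · simpa [θ, Function.update_of_ne hy] using HasSort.var y y.sort (Set.mem_univ y) le_rfl
  -- If `x` simplifies to `u'`, then iterating `x ↦ u'` gives an infinite chain, each step being a
  -- substitution instance of the previous one. Well-founded induction excludes all its members.
  have key : ∀ t : Term Sg, ∀ n : ℕ, t ≠ (Term.subst θ)^[n] (.var x) := by
    intro t
    induction t using hD.terminating.induction with
    | _ t ih =>
      rintro n rfl
      refine ih ((Term.subst θ)^[n + 1] (.var x)) ?_ (n + 1) rfl
      clear ih
      induction n with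
      | zero => simpa [Term.subst, θ] using hu'
      | succ n ihn =>
        rw [Function.iterate_succ_apply', Function.iterate_succ_apply' _ (n + 1)]
        exact ihn.subst hθ
  exact key _ 0 rfl

end IsFactAlgebra

end Presentation

/-- Every maximal rewriting sequence from a state reaches a state that satisfies `P`. -/
inductive Inevitable {X : Type*} (r : X → X → Prop) (P : X → Prop) : X → Prop
  | here {x : X} : P x → Inevitable r P x
  | step {x : X} : (∃ y, r x y) → (∀ y, r x y → Inevitable r P y) → Inevitable r P x

/-! ### Reasoning about all runs at once -/

namespace Inevitable

variable {X Y : Type*} {r : X → X → Prop} {P Q : X → Prop} {x y : X}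

theorem bind (h : Inevitable r P x) (hPQ : ∀ y, P y → Inevitable r Q y) : Inevitable r Q x := by
  induction h with
  | here h => exact hPQ _ h
  | step h _ ih => exact .step h ih

theorem step_unique (h : r x y) (huniq : ∀ z, r x z → z = y) (hy : Inevitable r P y) :
    Inevitable r P x :=
  .step ⟨y, h⟩ fun z hz => huniq z hz ▸ hy

theorem exists_reflTransGen (h : Inevitable r P x) : ∃ y, Relation.ReflTransGen r x y ∧ P y := by
  induction h with
  | here h => exact ⟨_, .refl, h⟩
  | step h _ ih =>
    obtain ⟨y, hy⟩ := h
    obtain ⟨z, hz, hP⟩ := ih y hy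
    exact ⟨z, .head hy hz, hP⟩

/-- States satisfying `P` must themselves be normal, since otherwise a run could pass through one
and end elsewhere. -/
theorem of_normal (h : Inevitable r P x) (hP : ∀ z, P z → ¬ ∃ z', r z z')
    (hxy : Relation.ReflTransGen r x y) (hy : ¬ ∃ z, r y z) : P y := by
  induction h with
  | here h =>
    rcases hxy.cases_head with rfl | ⟨z, hz, -⟩
    · exact h
    · exact (hP _ h ⟨z, hz⟩).elim
  | step h _ ih =>
    rcases hxy.cases_head with rfl | ⟨z, hz, hzy⟩
    · exact (hy h).elim
    · exact ih z hz hzy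

/-- A run that is simulated step by step. -/
theorem map {r' : Y → Y → Prop} (f : X → Y) (h : Inevitable r P x)
    (hf : ∀ x, (∃ x', r x x') → (∃ y, r' (f x) y) ∧ ∀ y, r' (f x) y → ∃ x', r x x' ∧ y = f x') :
    Inevitable r' (fun y => ∃ x, P x ∧ y = f x) (f x) := by
  induction h with
  | here h => exact .here ⟨_, h, rfl⟩
  | step h _ ih =>
    obtain ⟨h1, h2⟩ := hf _ h
    refine .step h1 fun y hy => ?_
    obtain ⟨x', hx', rfl⟩ := h2 y hy
    exact ih x' hx'

end Inevitable

namespace Presentation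

variable {D : Presentation Sg} {W : Set (Var Sg)}

/-! ## Denotations of terms -/

/-- Two substitutions realizing the same environment agree modulo `A ∪ E` on the variables, hence so
do the instances. This makes the steps that evaluate a term deterministic. -/
theorem Denotes.unique {ρ : D.Env} {t : Term Sg} {s : Sg.Srt} (ht : HasSort W t s) {d d' : D.Val}
    (h : D.Denotes ρ t d) (h' : D.Denotes ρ t d') : d = d' := by
  obtain ⟨σ, hσ, hρ, rfl⟩ := h
  obtain ⟨σ', hσ', hρ', rfl⟩ := h'
  refine (cls_eq_iff (ht.subst_of_vars hσ).wellSorted).2 (eqAE_subst_of_eqAE ht hσ hσ' ?_)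
  intro x hx
  refine (cls_eq_iff (hσ x hx).wellSorted).1 ?_
  exact Option.some_injective _ ((hρ x hx).symm.trans (hρ' x hx))

theorem ofBool_injective (hD : D.IsFactAlgebra) : Function.Injective D.ofBool := by
  have hw : WellSorted (Sg := Sg) ∅ (.app Sg.tt ![]) :=
    ⟨Sg.bool, .app _ _ (fun _ => Sg.bool) _ Sg.rank_tt fun i => i.elim0⟩
  have h : D.ofBool true ≠ D.ofBool false := fun h => hD.tt_ne_ff ((cls_eq_iff hw).1 h)
  intro b b' hb
  cases b <;> cases b' <;> simp_all

theorem exists_ofBool (hD : D.IsFactAlgebra) {t : Term Sg} (ht : HasSort ∅ t Sg.bool) :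
    ∃ b, D.cls t = D.ofBool b := by
  rcases hD.bool_cases t ht with h | h
  · exact ⟨true, (cls_eq_iff ht.wellSorted).2 h⟩
  · exact ⟨false, (cls_eq_iff ht.wellSorted).2 h⟩

/-! ## Evaluation of conditions -/

/-- Against the database `F`, the condition `ψ` always evaluates to the truth value of `p`. -/
def CEvals (F : Multiset D.Val) (ρ : D.Env) (ψ : Cond Sg) (p : Prop) : Prop :=
  ∀ S, Inevitable (D.CStep F) (fun Z => ∃ b : Bool, (b = true ↔ p) ∧ Z = .res b :: S)
    (.eval ρ ψ :: S)

namespace CEvals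

variable {F : Multiset D.Val} {ρ : D.Env} {ψ ψ' : Cond Sg} {p q : Prop}

theorem congr (h : CEvals F ρ ψ p) (hpq : p ↔ q) : CEvals F ρ ψ q := by
  rwa [← propext hpq]

theorem fls : CEvals F ρ .fls False := fun S =>
  .step_unique (.fls ρ S) (by rintro z ⟨⟩; rfl) (.here ⟨false, by simp, rfl⟩)

theorem bool (hD : D.IsFactAlgebra) {B : TermOf Sg Sg.bool} {b : Bool}
    (h : D.Denotes ρ B.1 (D.ofBool b)) : CEvals F ρ (.bool B) (b = true) := fun S => by
  refine .step_unique (.bool ρ B b S h) ?_ (.here ⟨b, Iff.rfl, rfl⟩)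
  rintro z (_ | _)
  rename_i b' hb'
  rw [ofBool_injective hD (h.unique B.2.1 hb')]

theorem neg (h : CEvals F ρ ψ p) : CEvals F ρ (.neg ψ) (¬ p) := fun S => by
  refine .step_unique (.neg_unfold ρ ψ S) (by rintro z ⟨⟩; rfl) ((h _).bind ?_)
  rintro _ ⟨b, hb, rfl⟩
  refine .step_unique (.neg_fold b S) (by rintro z ⟨⟩; rfl) (.here ⟨!b, ?_, rfl⟩)
  rw [← hb]
  simp

theorem or (h : CEvals F ρ ψ p) (h' : CEvals F ρ ψ' q) :
    CEvals F ρ (.or ψ ψ') (p ∨ q) := fun S => by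
  refine .step_unique (.or_unfold ρ ψ ψ' S) (by rintro z ⟨⟩; rfl) ((h' _).bind ?_)
  rintro _ ⟨b, hb, rfl⟩
  cases b with
  | true =>
    exact .step_unique (.or_fold_true ρ ψ S) (by rintro z ⟨⟩; rfl)
      (.here ⟨true, by simp [hb.1 rfl], rfl⟩)
  | false =>
    refine .step_unique (.or_fold_false ρ ψ S) (by rintro z ⟨⟩; rfl) ((h S).bind ?_)
    rintro _ ⟨b, hb', rfl⟩
    refine .here ⟨b, ?_, rfl⟩
    have : ¬ q := fun hq => by simpa using hb.2 hq
    simp [hb', this]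

end CEvals

/-! ## Evaluation of queries -/

/-- Against the database `F`, the query `Q` always evaluates to an answer with the set of
facts `T`. -/
def QEvals (F : Multiset D.Val) (ρ : D.Env) (Q : Query Sg) (T : Set D.Val) : Prop :=
  ∀ F' S, Inevitable D.QStep
    (fun Z => ∃ M : Multiset D.Val, (∀ d, d ∈ M ↔ d ∈ T) ∧ Z = .run F (F' + M) S)
    (.run F F' (.eval ρ Q :: S))

namespace QEvals

variable {F : Multiset D.Val} {ρ : D.Env} {Q Q' : Query Sg} {T T' : Set D.Val}

theorem congr (h : QEvals F ρ Q T) (hT : ∀ d, d ∈ T ↔ d ∈ T') : QEvals F ρ Q T' := by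
  rwa [← Set.ext hT]

theorem fact {f : TermOf Sg Sg.fact} {d : D.Val} (h : D.Denotes ρ f.1 d) :
    QEvals F ρ (.fact f) {d} := fun F' S => by
  refine .step_unique (.fact F F' ρ f d S h) ?_ (.here ⟨{d}, by simp, rfl⟩)
  rintro z (_ | _)
  rename_i d' hd'
  rw [h.unique f.2.1 hd']

theorem union (h : QEvals F ρ Q T) (h' : QEvals F ρ Q' T') :
    QEvals F ρ (.union Q Q') (T ∪ T') := fun F' S => by
  refine .step_unique (.union F F' ρ Q Q' S) (by rintro z (_ | _); rfl) ((h _ _).bind ?_)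
  rintro _ ⟨M, hM, rfl⟩
  refine (h' _ _).bind ?_
  rintro _ ⟨M', hM', rfl⟩
  exact .here ⟨M + M', by simp [hM, hM'], by rw [add_assoc]⟩

theorem cond {φ : Cond Sg} {p : Prop} (hφ : CEvals F ρ φ p) (h : QEvals F ρ Q T) :
    QEvals F ρ (.cond φ Q) {d | p ∧ d ∈ T} := fun F' S => by
  refine .step_unique (.cond_unfold F F' ρ φ Q S) (by rintro z (_ | _); rfl) ?_
  -- The run of the condition is lifted into its query frame. The fold rules cannot interfere before
  -- it ends: they need the stack `[.res b]`, from which no condition step is possible.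
  refine ((hφ []).map (fun S₁ => QState.run F F' (.cond ρ S₁ Q :: S)) ?_).bind ?_
  · rintro S₁ ⟨S₂, h₂⟩
    refine ⟨⟨_, .cond_step F F' ρ S₁ S₂ Q S h₂⟩, ?_⟩
    rintro y hy
    cases hy with
    | cond_fold_false => cases h₂
    | cond_fold_true => cases h₂
    | cond_step _ _ _ _ S₃ _ _ h₃ => exact ⟨S₃, h₃, rfl⟩
  · rintro _ ⟨_, ⟨b, hb, rfl⟩, rfl⟩
    have hnil : ∀ b S₂, ¬ D.CStep F [.res b] S₂ := by rintro b S₂ ⟨⟩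
    cases b with
    | true =>
      have hp : p := hb.1 rfl
      refine .step_unique (.cond_fold_true F F' ρ Q S) ?_ ?_
      · rintro z (_ | _)
        · rfl
        · exact (hnil _ _ (by assumption)).elim
      · simpa [hp] using h F' S
    | false =>
      have hp : ¬ p := fun hp => by simpa using hb.2 hp
      refine .step_unique (.cond_fold_false F F' ρ Q S) ?_ (.here ⟨0, by simp [hp], by simp⟩)
      rintro z (_ | _)
      · rfl
      · exact (hnil _ _ (by assumption)).elim

end QEvals

end Presentation

/-! ## Patterns for the facts of a relation -/

/-- The variable with index `x i` that stands for the `i`-th column of a row with columns `a`. -/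
def rowVar {n : ℕ} (a : Fin n → Sg.Srt) (x : Fin n → ℕ) (i : Fin n) : Var Sg := ⟨a i, x i⟩

theorem rowVar_injective {n : ℕ} (a : Fin n → Sg.Srt) {x : Fin n → ℕ}
    (hx : Function.Injective x) : Function.Injective (rowVar a x) :=
  fun _ _ h => hx (congrArg Var.idx h)

/-- The term that applies `c` to a row of variables. -/
def rowTerm {n : ℕ} (c : Sg.Fn n) (a : Fin n → Sg.Srt) (x : Fin n → ℕ) : Term Sg :=
  .app c fun i => .var (rowVar a x i)

theorem vars_rowTerm {n : ℕ} (c : Sg.Fn n) (a : Fin n → Sg.Srt) (x : Fin n → ℕ) :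
    (rowTerm c a x).vars = Set.range (rowVar a x) := by
  ext y
  simp [rowTerm, Term.vars, eq_comm]

namespace Presentation

variable {D : Presentation Sg} {n : ℕ} {c : Sg.Fn n} {a : Fin n → Sg.Srt}

theorem substOn_range {x : Fin n → ℕ} {σ : Var Sg → Term Sg}
    (h : SubstOn ∅ σ (Set.range (rowVar a x))) (i : Fin n) : HasSort ∅ (σ (rowVar a x i)) (a i) :=
  h _ ⟨i, rfl⟩

/-- The fact term `c(x 0, ..., x (n-1))`. -/
def rowFact (hc : D.IsFactConstructor c a) (x : Fin n → ℕ) : TermOf Sg Sg.fact :=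
  ⟨rowTerm c a x, hc.hasSort fun _ => .var _ _ trivial le_rfl, hc.visible, fun _ => trivial⟩

/-- The pattern `[c(x 0, ..., x (n-1))]_?`. -/
def rowPattern (hc : D.IsFactConstructor c a) (x : Fin n → ℕ) : Pattern Sg :=
  ⟨0, {rowFact hc x}, Multiset.singleton_ne_zero _⟩

theorem vars_rowPattern (hc : D.IsFactConstructor c a) (x : Fin n → ℕ) :
    (rowPattern hc x).vars = Set.range (rowVar a x) := by
  rw [← vars_rowTerm c a x]
  ext y
  constructor
  · rintro ⟨p, hp, hy⟩
    rw [rowPattern, zero_add, Multiset.mem_singleton] at hp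
    subst hp
    exact hy
  · exact fun hy => ⟨rowFact hc x, by simp [rowPattern], hy⟩

/-- Two matches have equal arguments modulo `A ∪ E` by injectivity of `c`. These are arguments of
reduced facts, hence reduced, hence equal modulo `A`. The pattern itself is reduced because
variables are. -/
theorem detPattern_rowPattern (hD : D.IsFactAlgebra) (hc : D.IsFactConstructor c a)
    (x : Fin n → ℕ) : D.DetPattern (rowPattern hc x) := by
  refine ⟨rfl, _, rfl, hc.reduced _ _ (fun _ => .var _ _ trivial le_rfl)
    fun _ => hD.reduced_var _, ?_⟩
  intro t _ htr σ σ' hσ hσ' h h' y hy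
  rw [show (rowFact hc x).1 = rowTerm c a x from rfl, vars_rowTerm] at hσ hσ' hy
  obtain ⟨i, rfl⟩ := hy
  have hi := hc.injective _ _ (substOn_range hσ) (substOn_range hσ') (h.trans h'.symm).eqAE i
  exact hD.eqA_of_eqAE_of_reduced (hD.reduced_arg (htr.eqA h.symm) i)
    (hD.reduced_arg (htr.eqA h'.symm) i) hi

/-- The substitution of representatives for the values of an environment. -/
noncomputable def Env.ground (ρ : D.Env) (y : Var Sg) : Term Sg :=
  (ρ y).elim (.var y) (D.rep y.sort)

theorem Env.ground_of_eq_some {ρ : D.Env} {y : Var Sg} {d : D.Val} (h : ρ y = some d) :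
    ρ.ground y = D.rep y.sort d := by
  rw [Env.ground, h, Option.elim_some]

theorem denotes_ground {ρ : D.Env} {t : Term Sg}
    (hρ : ∀ y ∈ t.vars, ∃ d ∈ D.carrier y.sort, ρ y = some d) :
    SubstOn ∅ ρ.ground t.vars ∧ D.Denotes ρ t (D.cls (t.subst ρ.ground)) := by
  have hs : SubstOn ∅ ρ.ground t.vars := fun y hy => by
    obtain ⟨d, hd, hy⟩ := hρ y hy
    rw [Env.ground_of_eq_some hy]
    exact hasSort_rep hd
  refine ⟨hs, ρ.ground, hs, fun y hy => ?_, rfl⟩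
  obtain ⟨d, hd, hy⟩ := hρ y hy
  rw [Env.ground_of_eq_some hy, hy, cls_rep hd]

theorem denotes_rowTerm {c : Sg.Fn n} {x : Fin n → ℕ} {ρ : D.Env}
    {t : Fin n → D.Val} (ht : ∀ i, t i ∈ D.carrier (a i))
    (hρ : ∀ i, ρ (rowVar a x i) = some (t i)) : D.Denotes ρ (rowTerm c a x) (D.opVal c a t) := by
  have h := (denotes_ground (D := D) (ρ := ρ) (t := rowTerm c a x) (by
    rw [vars_rowTerm]
    rintro _ ⟨i, rfl⟩
    exact ⟨t i, ht i, hρ i⟩)).2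
  have h' : (rowTerm c a x).subst ρ.ground = .app c fun i => D.rep (a i) (t i) := by
    simp only [rowTerm, Term.subst]
    congr 1
    funext i
    exact Env.ground_of_eq_some (hρ i)
  rwa [h'] at h

/-- The environment `ρ` with the row `t` assigned to the variables `x`. -/
noncomputable def Env.row (ρ : D.Env) (a : Fin n → Sg.Srt) (x : Fin n → ℕ) (t : Fin n → D.Val) :
    D.Env :=
  Function.extend (rowVar a x) (fun i => some (t i)) ρ

theorem Env.row_rowVar (ρ : D.Env) {x : Fin n → ℕ} (hx : Function.Injective x)
    (t : Fin n → D.Val) (i : Fin n) : ρ.row a x t (rowVar a x i) = some (t i) :=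
  (rowVar_injective a hx).extend_apply _ _ i

theorem Env.row_of_notMem (ρ : D.Env) {x : Fin n → ℕ} (t : Fin n → D.Val) {y : Var Sg}
    (hy : y ∉ Set.range (rowVar a x)) : ρ.row a x t y = ρ y :=
  Function.extend_apply' _ _ _ hy

/-- Since the variables are unbound in `ρ`, a match is nothing but the choice of a row whose fact
occurs in the iterator state, and it removes one occurrence of that fact. -/
theorem match_rowPattern_iff (hD : D.IsFactAlgebra) (hc : D.IsFactConstructor c a) {x : Fin n → ℕ}
    (hx : Function.Injective x) {ρ ρ' : D.Env} (hρ : ∀ i, ρ (rowVar a x i) = none)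
    {F F' : Multiset D.Val} :
    D.Match (rowPattern hc x) ρ F F' ρ' ↔ ∃ t : Fin n → D.Val, (∀ i, t i ∈ D.carrier (a i)) ∧
      F = F' + {D.opVal c a t} ∧ ρ' = ρ.row a x t := by
  constructor
  · rintro ⟨σ, G, hσ, -, -, hF, hF', hρ', hρ''⟩
    rw [vars_rowPattern] at hσ hρ' hρ''
    have hs := substOn_range hσ
    refine ⟨fun i => D.cls (σ (rowVar a x i)), fun i => ⟨_, hs i, rfl⟩, ?_, ?_⟩
    · rw [hc.opVal_eq_cls hs, hF, hF']
      rfl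
    · funext y
      by_cases hy : y ∈ Set.range (rowVar a x)
      · rw [hρ' y hy]
        obtain ⟨i, rfl⟩ := hy
        rw [Env.row_rowVar ρ hx]
      · rw [hρ'' y hy, Env.row_of_notMem ρ _ hy]
  · rintro ⟨t, ht, hF, rfl⟩
    -- The representatives given by `rep` need not be reduced, while a match requires reduced
    -- instances; so reduced ones are taken.
    choose w hw hwr hwt using fun i => hD.exists_reduced_of_mem_carrier (ht i)
    let σ : Var Sg → Term Sg := Function.extend (rowVar a x) w Term.var
    have hσ : ∀ i, σ (rowVar a x i) = w i := (rowVar_injective a hx).extend_apply _ _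
    have hsub : (rowFact hc x).1.subst σ = .app c w := by
      simp only [rowFact, rowTerm, Term.subst, hσ]
    refine ⟨σ, F', ?_, ?_, ?_, ?_, ?_, ?_, ?_⟩
    · rw [vars_rowPattern]
      rintro _ ⟨i, rfl⟩
      rw [hσ]
      exact hw i
    · rw [vars_rowPattern]
      rintro _ ⟨i, rfl⟩ d hd
      rw [hρ i] at hd
      cases hd
    · intro p hp
      rw [rowPattern, zero_add, Multiset.mem_singleton] at hp
      rw [hp, hsub]
      exact hc.reduced _ _ hw hwr
    · rw [hF, ← funext hwt, hc.opVal_eq_cls hw, ← hsub]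
      simp [rowPattern]
    · simp [rowPattern]
    · rw [vars_rowPattern]
      rintro _ ⟨i, rfl⟩
      rw [Env.row_rowVar ρ hx, hσ, hwt]
    · rw [vars_rowPattern]
      exact fun y hy => Env.row_of_notMem ρ t hy

end Presentation

/-! ## Iteration over a relation -/

section Iteration

variable {D : Presentation Sg} {𝒮 : Schema.{u, v, w} Sg} {sym : ∀ r : 𝒮.Rel, Sg.Fn (𝒮.arity r)}

open Presentation

theorem Database.mem_toFacts (I : Database D 𝒮) {d : D.Val} :
    d ∈ I.toFacts sym ↔ ∃ r, ∃ t ∈ I.rel r, D.opVal (sym r) (𝒮.cols r) t = d := by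
  simp [Database.toFacts, Multiset.mem_sum]

variable (hsym : ∀ r, D.IsFactConstructor (sym r) (𝒮.cols r))
include hsym

/-- Disjointness excludes that the fact comes from another relation, and injectivity recovers the
row within the same relation. -/
theorem Database.opVal_mem_toFacts_iff
    (hdisj : ∀ r r', r ≠ r' →
      D.DisjointConstructors (sym r) (𝒮.cols r) (sym r') (𝒮.cols r'))
    (I : Database D 𝒮) {r : 𝒮.Rel} {t : Fin (𝒮.arity r) → D.Val}
    (ht : ∀ i, t i ∈ D.carrier (𝒮.cols r i)) :
    D.opVal (sym r) (𝒮.cols r) t ∈ I.toFacts sym ↔ t ∈ I.rel r := by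
  rw [I.mem_toFacts]
  refine ⟨?_, fun h => ⟨r, t, h, rfl⟩⟩
  rintro ⟨r', t', ht', heq⟩
  by_cases hr : r' = r
  · subst hr
    rwa [(hsym r').opVal_inj (I.sorted _ _ ht') ht heq] at ht'
  · exact ((hdisj r' r hr).opVal_ne (hsym r') (I.sorted _ _ ht') ht heq).elim

/-- The rows of the relation `r` in the multiset of facts `F`. -/
def rowsIn (D : Presentation Sg) (sym : ∀ r : 𝒮.Rel, Sg.Fn (𝒮.arity r)) (F : Multiset D.Val)
    (r : 𝒮.Rel) : Set (Fin (𝒮.arity r) → D.Val) :=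
  {t | (∀ i, t i ∈ D.carrier (𝒮.cols r i)) ∧ D.opVal (sym r) (𝒮.cols r) t ∈ F}

theorem rowsIn_toFacts (hdisj : ∀ r r', r ≠ r' →
      D.DisjointConstructors (sym r) (𝒮.cols r) (sym r') (𝒮.cols r'))
    (I : Database D 𝒮) (r : 𝒮.Rel) : rowsIn D sym (I.toFacts sym) r = I.rel r := by
  ext t
  constructor
  · rintro ⟨h1, h2⟩
    exact (I.opVal_mem_toFacts_iff hsym hdisj h1).1 h2
  · exact fun h => ⟨I.sorted r t h, (I.opVal_mem_toFacts_iff hsym hdisj (I.sorted r t h)).2 h⟩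

/-- The two cases may overlap: other occurrences of the fact of `t₀` may be left in `F`. This is
harmless because only sets of rows are tracked. -/
theorem mem_rowsIn_add {F : Multiset D.Val} {r : 𝒮.Rel} {t₀ : Fin (𝒮.arity r) → D.Val}
    (ht₀ : ∀ i, t₀ i ∈ D.carrier (𝒮.cols r i)) {t : Fin (𝒮.arity r) → D.Val} :
    t ∈ rowsIn D sym (F + {D.opVal (sym r) (𝒮.cols r) t₀}) r ↔ t ∈ rowsIn D sym F r ∨ t = t₀ := by
  simp only [rowsIn, Set.mem_ofPred_eq, Multiset.mem_add, Multiset.mem_singleton]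
  constructor
  · rintro ⟨h1, h2 | h2⟩
    · exact .inl ⟨h1, h2⟩
    · exact .inr ((hsym r).opVal_inj h1 ht₀ h2)
  · rintro (⟨h1, h2⟩ | rfl)
    · exact ⟨h1, .inl h2⟩
    · exact ⟨ht₀, .inr rfl⟩

variable (hD : D.IsFactAlgebra) {F₀ : Multiset D.Val} {ρ : D.Env} {r : 𝒮.Rel}
  {x : Fin (𝒮.arity r) → ℕ} (hx : Function.Injective x)
  (hρ : ∀ i, ρ (rowVar (𝒮.cols r) x i) = none)
include hD hx hρ

/-- Induction on the size of the iterator state `F`, which drops by one with each match. The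
condition `ψ` is always evaluated on the full database `F₀`, whatever has been consumed. -/
theorem inevitable_iter_cond {ψ : Cond Sg} {κ : (Fin (𝒮.arity r) → D.Val) → Prop}
    (S : List D.CFrame) (F : Multiset D.Val)
    (h : ∀ t ∈ rowsIn D sym F r, CEvals F₀ (ρ.row (𝒮.cols r) x t) ψ (κ t)) :
    Inevitable (D.CStep F₀)
      (fun Z => ∃ b : Bool, (b = true ↔ ∃ t ∈ rowsIn D sym F r, κ t) ∧ Z = .res b :: S)
      (.iter F ρ (rowPattern (hsym r) x) ψ :: S) := by
  induction hn : F.card using Nat.strong_induction_on generalizing F with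
  | _ n ih =>
  subst hn
  by_cases hex : ∃ F₂ ρ', D.Match (rowPattern (hsym r) x) ρ F F₂ ρ'
  · obtain ⟨F₂, ρ', hm⟩ := id hex
    refine .step ⟨_, .ex_unfold F F₂ ρ ρ' _ ψ S hm⟩ ?_
    -- This match only shows that some step exists; an arbitrary match is treated next.
    clear hm F₂ ρ'
    rintro z (_ | _)
    · rename_i F₂ ρ' hm
      obtain ⟨t₀, ht₀, rfl, rfl⟩ := (match_rowPattern_iff hD (hsym r) hx hρ).1 hm
      have hmem := fun t => mem_rowsIn_add hsym (F := F₂) ht₀ (t := t)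
      refine (h t₀ ((hmem t₀).2 (.inr rfl)) _).bind ?_
      rintro _ ⟨b, hb, rfl⟩
      cases b with
      | true =>
        exact .step_unique (.ex_fold_true F₂ ρ _ ψ S) (by rintro z ⟨⟩; rfl)
          (.here ⟨true, iff_of_true rfl ⟨t₀, (hmem t₀).2 (.inr rfl), hb.1 rfl⟩, rfl⟩)
      | false =>
        refine .step_unique (.ex_fold_false F₂ ρ _ ψ S) (by rintro z ⟨⟩; rfl) ?_
        refine (ih F₂.card (by simp) F₂ (fun t ht => h t ((hmem t).2 (.inl ht))) rfl).bind ?_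
        rintro _ ⟨b, hb', rfl⟩
        refine .here ⟨b, hb'.trans ⟨?_, ?_⟩, rfl⟩
        · rintro ⟨t, ht, hκ⟩
          exact ⟨t, (hmem t).2 (.inl ht), hκ⟩
        · rintro ⟨t, ht, hκ⟩
          rcases (hmem t).1 ht with ht | rfl
          · exact ⟨t, ht, hκ⟩
          · simpa using hb.2 hκ
    · exact absurd hex (by assumption)
  · refine .step_unique (.ex_end F ρ _ ψ S hex) ?_ (.here ⟨false, ?_, rfl⟩)
    · rintro z (_ | _)
      · exact absurd ⟨_, _, by assumption⟩ hex
      · rfl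
    · refine iff_of_false (by simp) ?_
      rintro ⟨t, ⟨ht, htF⟩, -⟩
      -- When no match is left there is no row left, as splitting off its fact would give a match.
      obtain ⟨F₂, hF⟩ := Multiset.exists_cons_of_mem htF
      refine hex ⟨F₂, _, (match_rowPattern_iff hD (hsym r) hx hρ).2 ⟨t, ht, ?_, rfl⟩⟩
      rw [hF, add_comm, Multiset.singleton_add]

/-- As for conditions, but without early exit: the answers for the matched row and for the remaining
iteration add up. -/
theorem inevitable_iter_query {Q : Query Sg} {K : (Fin (𝒮.arity r) → D.Val) → Set D.Val}
    (F' : Multiset D.Val) (S : List D.QFrame) (F : Multiset D.Val)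
    (h : ∀ t ∈ rowsIn D sym F r, QEvals F₀ (ρ.row (𝒮.cols r) x t) Q (K t)) :
    Inevitable D.QStep
      (fun Z => ∃ M : Multiset D.Val, (∀ d, d ∈ M ↔ ∃ t ∈ rowsIn D sym F r, d ∈ K t) ∧
        Z = .run F₀ (F' + M) S)
      (.run F₀ F' (.iter F ρ (rowPattern (hsym r) x) Q :: S)) := by
  induction hn : F.card using Nat.strong_induction_on generalizing F F' with
  | _ n ih =>
  subst hn
  by_cases hex : ∃ F₂ ρ', D.Match (rowPattern (hsym r) x) ρ F F₂ ρ'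
  · obtain ⟨F₂, ρ', hm⟩ := id hex
    refine .step ⟨_, .from_unfold F₀ F' F F₂ ρ ρ' _ Q S hm⟩ ?_
    clear hm F₂ ρ'
    rintro z (_ | _)
    · rename_i F₂ ρ' hm
      obtain ⟨t₀, ht₀, rfl, rfl⟩ := (match_rowPattern_iff hD (hsym r) hx hρ).1 hm
      have hmem := fun t => mem_rowsIn_add hsym (F := F₂) ht₀ (t := t)
      refine (h t₀ ((hmem t₀).2 (.inr rfl)) _ _).bind ?_
      rintro _ ⟨M, hM, rfl⟩
      refine (ih F₂.card (by simp) _ F₂ (fun t ht => h t ((hmem t).2 (.inl ht))) rfl).bind ?_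
      rintro _ ⟨M', hM', rfl⟩
      refine .here ⟨M + M', fun d => ?_, by rw [add_assoc]⟩
      simp only [Multiset.mem_add, hM, hM', hmem]
      constructor
      · rintro (hd | ⟨t, ht, hd⟩)
        · exact ⟨t₀, .inr rfl, hd⟩
        · exact ⟨t, .inl ht, hd⟩
      · rintro ⟨t, ht | rfl, hd⟩
        · exact .inr ⟨t, ht, hd⟩
        · exact .inl hd
    · exact absurd hex (by assumption)
  · refine .step_unique (.from_end F₀ F' F ρ _ Q S hex) ?_ (.here ⟨0, fun d => ?_, by simp⟩)
    · rintro z (_ | _)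
      · exact absurd ⟨_, _, by assumption⟩ hex
      · rfl
    · refine iff_of_false (by simp) ?_
      rintro ⟨t, ⟨ht, htF⟩, -⟩
      obtain ⟨F₂, hF⟩ := Multiset.exists_cons_of_mem htF
      refine hex ⟨F₂, _, (match_rowPattern_iff hD (hsym r) hx hρ).2 ⟨t, ht, ?_, rfl⟩⟩
      rw [hF, add_comm, Multiset.singleton_add]

variable (hdisj : ∀ r r', r ≠ r' →
  D.DisjointConstructors (sym r) (𝒮.cols r) (sym r') (𝒮.cols r')) (I : Database D 𝒮)
include hdisj

theorem Presentation.CEvals.ex_rowPattern {ψ : Cond Sg} {κ : (Fin (𝒮.arity r) → D.Val) → Prop}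
    (h : ∀ t ∈ I.rel r, CEvals (I.toFacts sym) (ρ.row (𝒮.cols r) x t) ψ (κ t)) :
    CEvals (I.toFacts sym) ρ (.ex (rowPattern (hsym r) x) ψ) (∃ t ∈ I.rel r, κ t) := fun S => by
  rw [← rowsIn_toFacts hsym hdisj I r] at h ⊢
  exact .step_unique (.ex_init ρ _ ψ S) (by rintro z ⟨⟩; rfl)
    (inevitable_iter_cond hsym hD hx hρ S _ h)

theorem Presentation.QEvals.from_rowPattern {Q : Query Sg}
    {K : (Fin (𝒮.arity r) → D.Val) → Set D.Val}
    (h : ∀ t ∈ I.rel r, QEvals (I.toFacts sym) (ρ.row (𝒮.cols r) x t) Q (K t)) :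
    QEvals (I.toFacts sym) ρ (.from (rowPattern (hsym r) x) Q) {d | ∃ t ∈ I.rel r, d ∈ K t} :=
  fun F' S => by
  rw [← rowsIn_toFacts hsym hdisj I r] at h ⊢
  exact .step_unique (.from_init _ F' ρ _ Q S) (by rintro z (_ | _); rfl)
    (inevitable_iter_query hsym hD hx hρ F' S _ h)

end Iteration

open Presentation

/-! ## Conditions on rows of variables -/

def Cond.and (ψ ψ' : Cond Sg) : Cond Sg := .neg (.or (.neg ψ) (.neg ψ'))

/-- Equality of the variables of sort `s` with indices `i` and `j`. -/
def Cond.eqVar (s : Sg.Srt) (i j : ℕ) : Cond Sg :=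
  .bool ⟨.app (Sg.eq s) ![.var ⟨s, i⟩, .var ⟨s, j⟩],
    .app _ _ (fun _ => s) _ (Sg.rank_eq s) fun l => by
      fin_cases l <;> exact .var _ _ trivial le_rfl,
    Sg.visible_eq s, fun l => by fin_cases l <;> trivial⟩

/-- Equality of rows. -/
def Cond.eqRow {n : ℕ} (a : Fin n → Sg.Srt) (x y : Fin n → ℕ) : Cond Sg :=
  (List.finRange n).foldr (fun i ψ => (Cond.eqVar (a i) (x i) (y i)).and ψ) (.neg .fls)

/-- The substitution that replaces the column variables by the variables with indices `x`. -/
noncomputable def colSubst {n : ℕ} (a : Fin n → Sg.Srt) (x : Fin n → ℕ) : Var Sg → Term Sg :=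
  Function.extend (colVar a) (fun i => .var (rowVar a x i)) .var

theorem colSubst_colVar {n : ℕ} (a : Fin n → Sg.Srt) (x : Fin n → ℕ) (i : Fin n) :
    colSubst a x (colVar a i) = .var (rowVar a x i) :=
  (rowVar_injective a Fin.val_injective).extend_apply _ _ i

theorem visible_colSubst {n : ℕ} (a : Fin n → Sg.Srt) (x : Fin n → ℕ) (y : Var Sg) :
    (colSubst a x y).Visible := by
  by_cases hy : ∃ i, colVar a i = y
  · obtain ⟨i, rfl⟩ := hy
    rw [colSubst_colVar]
    trivial
  · rw [colSubst, Function.extend_apply' _ _ _ hy]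
    trivial

theorem substOn_colSubst {n : ℕ} (a : Fin n → Sg.Srt) (x : Fin n → ℕ) {W : Set (Var Sg)}
    (hW : Set.range (rowVar a x) ⊆ W) : SubstOn W (colSubst a x) (Set.range (colVar a)) := by
  rintro _ ⟨i, rfl⟩
  rw [colSubst_colVar]
  exact .var _ _ (hW ⟨i, rfl⟩) le_rfl

/-- The selection condition `φ` for the row of variables `x`. -/
noncomputable def RowCond.toCond {n : ℕ} {a : Fin n → Sg.Srt} (φ : RowCond a) (x : Fin n → ℕ) :
    Cond Sg :=
  .bool ⟨φ.1.subst (colSubst a x),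
    φ.2.1.subst (substOn_colSubst a x (Set.subset_univ _)),
    φ.2.2.subst (visible_colSubst a x)⟩

/-! ### Closedness of row conditions -/

section Closed

variable {n : ℕ} {a : Fin n → Sg.Srt} {x y : Fin n → ℕ} {V : Set (Var Sg)}

theorem Cond.ClosedIn.eqRow (hx : ∀ i, rowVar a x i ∈ V) (hy : ∀ i, rowVar a y i ∈ V) :
    (Cond.eqRow a x y).ClosedIn V := by
  unfold Cond.eqRow
  induction List.finRange n with
  | nil => trivial
  | cons i l ih =>
    refine ⟨?_, ih⟩
    show Term.vars _ ⊆ V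
    refine Set.iUnion_subset fun j => ?_
    fin_cases j
    · simpa [Term.vars, rowVar] using hx i
    · simpa [Term.vars, rowVar] using hy i

theorem RowCond.closedIn_toCond (φ : RowCond a) (hx : ∀ i, rowVar a x i ∈ V) :
    (φ.toCond x).ClosedIn V := by
  refine ((φ.2.1.subst (substOn_colSubst a x subset_rfl)).vars_subset).trans ?_
  rintro _ ⟨i, rfl⟩
  exact hx i

end Closed

namespace Presentation

variable {D : Presentation Sg}

theorem detCond_eqRow {n : ℕ} (a : Fin n → Sg.Srt) (x y : Fin n → ℕ) :
    D.DetCond (Cond.eqRow a x y) := by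
  unfold Cond.eqRow
  induction List.finRange n with
  | nil => trivial
  | cons i l ih => exact ⟨trivial, ih⟩

/-! ### Truth values of row conditions -/

namespace CEvals

variable {F : Multiset D.Val} {ρ : D.Env}

theorem and {ψ ψ' : Cond Sg} {p q : Prop} (h : CEvals F ρ ψ p) (h' : CEvals F ρ ψ' q) :
    CEvals F ρ (ψ.and ψ') (p ∧ q) :=
  (h.neg.or h'.neg).neg.congr (by tauto)

variable (hD : D.IsFactAlgebra)
include hD

theorem eqVar {s : Sg.Srt} {i j : ℕ} {d e : D.Val} (hd : d ∈ D.carrier s) (he : e ∈ D.carrier s)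
    (hi : ρ ⟨s, i⟩ = some d) (hj : ρ ⟨s, j⟩ = some e) :
    CEvals F ρ (.eqVar s i j) (d = e) := by
  have hd' := hasSort_rep hd
  have he' := hasSort_rep he
  let T : Term Sg := .app (Sg.eq s) ![.var ⟨s, i⟩, .var ⟨s, j⟩]
  have hT : T.subst ρ.ground = .app (Sg.eq s) ![D.rep s d, D.rep s e] := by
    simp only [T, Term.subst]
    congr 1
    funext l
    fin_cases l
    · exact Env.ground_of_eq_some hi
    · exact Env.ground_of_eq_some hj
  have hv : ∀ y ∈ T.vars, ∃ d ∈ D.carrier y.sort, ρ y = some d := by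
    intro y hy
    obtain ⟨l, hl⟩ := Set.mem_iUnion.1 hy
    fin_cases l
    · cases hl
      exact ⟨d, hd, hi⟩
    · cases hl
      exact ⟨e, he, hj⟩
  have hden := (denotes_ground hv).2
  rw [hT] at hden
  have hs : HasSort ∅ (.app (Sg.eq s) ![D.rep s d, D.rep s e]) Sg.bool :=
    .app _ _ (fun _ => s) _ (Sg.rank_eq s) fun l => by fin_cases l <;> assumption
  obtain ⟨b, hb⟩ := exists_ofBool hD hs
  rw [hb] at hden
  refine (CEvals.bool hD (B := ⟨T, _⟩) hden).congr ?_
  rw [← (ofBool_injective hD).eq_iff, ← hb]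
  refine (cls_eq_iff hs.wellSorted).trans ((hD.eq_iff s _ _ hd' he').trans ?_)
  rw [← cls_eq_iff hd'.wellSorted, cls_rep hd, cls_rep he]

variable {n : ℕ} {a : Fin n → Sg.Srt} {x y : Fin n → ℕ} {t t' : Fin n → D.Val}
  (ht : ∀ i, t i ∈ D.carrier (a i)) (hx : ∀ i, ρ (rowVar a x i) = some (t i))
include ht hx

theorem eqRow (ht' : ∀ i, t' i ∈ D.carrier (a i)) (hy : ∀ i, ρ (rowVar a y i) = some (t' i)) :
    CEvals F ρ (.eqRow a x y) (t = t') := by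
  suffices H : ∀ l : List (Fin n), CEvals F ρ
      (l.foldr (fun i ψ => (Cond.eqVar (a i) (x i) (y i)).and ψ) (.neg .fls))
      (∀ i ∈ l, t i = t' i) from
    (H (List.finRange n)).congr (by simp [funext_iff])
  intro l
  induction l with
  | nil => exact CEvals.fls.neg.congr (by simp)
  | cons i l ih => exact ((eqVar hD (ht i) (ht' i) (hx i) (hy i)).and ih).congr (by simp)

theorem toCond (φ : RowCond a) : CEvals F ρ (φ.toCond x) (φ.Holds D t) := by
  have hv : ∀ y ∈ (φ.1.subst (colSubst a x)).vars, ∃ d ∈ D.carrier y.sort, ρ y = some d := by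
    intro y hy
    obtain ⟨i, rfl⟩ := (φ.2.1.subst (substOn_colSubst a x subset_rfl)).vars_subset hy
    exact ⟨t i, ht i, hx i⟩
  obtain ⟨hsub, hden⟩ := denotes_ground hv
  rw [Term.subst_subst] at hden
  let σ : Var Sg → Term Sg := fun y => (colSubst a x y).subst ρ.ground
  have hσ : ∀ i, σ (colVar a i) = D.rep (a i) (t i) := fun i => by
    simp only [σ, colSubst_colVar]
    exact Env.ground_of_eq_some (hx i)
  have hσs : SubstOn ∅ σ (Set.range (colVar a)) := by
    rintro _ ⟨i, rfl⟩
    rw [hσ]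
    exact hasSort_rep (ht i)
  have hs := φ.2.1.subst hσs
  obtain ⟨b, hb⟩ := exists_ofBool hD hs
  rw [hb] at hden
  refine (CEvals.bool hD (B := ⟨_, _⟩) hden).congr ?_
  rw [← (ofBool_injective hD).eq_iff, ← hb]
  refine ⟨fun h => ⟨σ, hσs, fun i => by rw [hσ, cls_rep (ht i)], h⟩, ?_⟩
  -- `RowCond.Holds` allows any substitution representing the row; by congruence its verdict is that
  -- of the chosen representatives.
  rintro ⟨σ', hσ's, hσ', h⟩
  rw [← h]
  have hsub := φ.2.1.vars_subset
  refine (cls_eq_iff hs.wellSorted).2 (eqAE_subst_of_eqAE φ.2.1 (fun y hy => hσs y (hsub hy))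
    (fun y hy => hσ's y (hsub hy)) fun y hy => ?_)
  obtain ⟨i, rfl⟩ := hsub hy
  rw [← cls_eq_iff (hσs _ ⟨i, rfl⟩).wellSorted, hσ, hσ', cls_rep (ht i)]

end CEvals

end Presentation

/-! ## Translation of relational algebra -/

theorem append_sorted {D : Presentation Sg} {n m : ℕ} {a : Fin n → Sg.Srt} {b : Fin m → Sg.Srt}
    {t : Fin n → D.Val} {s : Fin m → D.Val} (ht : ∀ i, t i ∈ D.carrier (a i))
    (hs : ∀ i, s i ∈ D.carrier (b i)) (i : Fin (n + m)) :
    Fin.append t s i ∈ D.carrier (Fin.append a b i) := by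
  refine Fin.addCases (fun i => ?_) (fun i => ?_) i
  · simpa using ht i
  · simpa using hs i

theorem RelExpr.eval_sorted {D : Presentation Sg} {𝒮 : Schema.{u, v, w} Sg} (I : Database D 𝒮)
    {n : ℕ} {a : Fin n → Sg.Srt} (R : RelExpr 𝒮 a) :
    ∀ t ∈ R.eval I, ∀ i, t i ∈ D.carrier (a i) := by
  induction R with
  | base r => exact I.sorted r
  | proj j R ih =>
    rintro _ ⟨s, hs, rfl⟩ i
    exact ih s hs (j i)
  | sel φ R ih => exact fun t ht => ih t ht.1
  | union R S ih ih' => exact fun t ht => ht.elim (ih t) (ih' t)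
  | prod R S ih ih' =>
    rintro _ ⟨r, hr, s, hs, rfl⟩
    exact append_sorted (ih r hr) (ih' s hs)
  | diff R S ih ih' => exact fun t ht => ih t ht.1

/-- Splits a claim about the variables of a product row into claims about its two factors; it serves
both for closedness and for the values in an environment. -/
theorem forall_rowVar_append {n m : ℕ} {a : Fin n → Sg.Srt} {b : Fin m → Sg.Srt}
    {x : Fin n → ℕ} {y : Fin m → ℕ} {P : Fin (n + m) → Var Sg → Prop}
    (hx : ∀ i, P (Fin.castAdd m i) (rowVar a x i)) (hy : ∀ i, P (Fin.natAdd n i) (rowVar b y i))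
    (i : Fin (n + m)) : P i (rowVar (Fin.append a b) (Fin.append x y) i) := by
  refine Fin.addCases (fun i => ?_) (fun i => ?_) i
  · simpa [rowVar] using hx i
  · simpa [rowVar] using hy i

section Translation

variable {D : Presentation Sg} {𝒮 : Schema.{u, v, w} Sg} {sym : ∀ r : 𝒮.Rel, Sg.Fn (𝒮.arity r)}
  (hsym : ∀ r, D.IsFactConstructor (sym r) (𝒮.cols r))

/-- A condition that holds if `k` holds for some row of the expression. The variables with indices
at least `N` are fresh, and `k` is given the variables for the row and a new bound for the indices
of fresh variables. -/
noncomputable def RelExpr.toCond : ∀ {n : ℕ} {a : Fin n → Sg.Srt}, RelExpr 𝒮 a → ℕ →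
    ((Fin n → ℕ) → ℕ → Cond Sg) → Cond Sg
  | _, _, .base r, N, k =>
    .ex (rowPattern (hsym r) fun i => N + i) (k (fun i => N + i) (N + 𝒮.arity r))
  | _, _, .proj i R, N, k => R.toCond N fun x M => k (x ∘ i) M
  | _, _, .sel φ R, N, k => R.toCond N fun x M => (φ.toCond x).and (k x M)
  | _, _, .union R S, N, k => .or (R.toCond N k) (S.toCond N k)
  | _, _, .prod R S, N, k => R.toCond N fun x M => S.toCond M fun y M' => k (Fin.append x y) M'
  | _, a, .diff R S, N, k => R.toCond N fun x M =>
    (Cond.neg (S.toCond M fun y _ => .eqRow a x y)).and (k x M)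

/-- A query that unites the answers of `k` for the rows of the expression; see `RelExpr.toCond`. -/
noncomputable def RelExpr.toQuery : ∀ {n : ℕ} {a : Fin n → Sg.Srt}, RelExpr 𝒮 a → ℕ →
    ((Fin n → ℕ) → ℕ → Query Sg) → Query Sg
  | _, _, .base r, N, k =>
    .from (rowPattern (hsym r) fun i => N + i) (k (fun i => N + i) (N + 𝒮.arity r))
  | _, _, .proj i R, N, k => R.toQuery N fun x M => k (x ∘ i) M
  | _, _, .sel φ R, N, k => R.toQuery N fun x M => .cond (φ.toCond x) (k x M)
  | _, _, .union R S, N, k => .union (R.toQuery N k) (S.toQuery N k)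
  | _, _, .prod R S, N, k => R.toQuery N fun x M => S.toQuery M fun y M' => k (Fin.append x y) M'
  | _, a, .diff R S, N, k => R.toQuery N fun x M =>
    .cond (.neg (S.toCond hsym M fun y _ => .eqRow a x y)) (k x M)

/-- The continuation is tested in every larger context, because by the time it is reached the
enclosing quantifiers have bound further variables. -/
theorem RelExpr.closedIn_toCond {n : ℕ} {a : Fin n → Sg.Srt} (R : RelExpr 𝒮 a) (V : Set (Var Sg))
    (N : ℕ) (k : (Fin n → ℕ) → ℕ → Cond Sg)
    (hk : ∀ V' x M, V ⊆ V' → (∀ i, rowVar a x i ∈ V') → (k x M).ClosedIn V') :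
    (R.toCond hsym N k).ClosedIn V := by
  induction R generalizing V N with
  | base r =>
    refine hk _ _ _ Set.subset_union_left fun i => ?_
    rw [vars_rowPattern]
    exact .inr ⟨i, rfl⟩
  | proj j R ih => exact ih V N _ fun V' x M hV hx => hk V' _ M hV fun i => hx (j i)
  | sel φ R ih =>
    exact ih V N _ fun V' x M hV hx => ⟨φ.closedIn_toCond hx, hk V' x M hV hx⟩
  | union R S ih ih' => exact ⟨ih V N k hk, ih' V N k hk⟩
  | prod R S ih ih' =>
    exact ih V N _ fun V' x M hV hx => ih' V' M _ fun V'' y M' hV' hy =>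
      hk V'' _ M' (hV.trans hV')
        (forall_rowVar_append (P := fun _ z => z ∈ V'') (fun i => hV' (hx i)) hy)
  | diff R S ih ih' =>
    exact ih V N _ fun V' x M hV hx => ⟨ih' V' M _ fun V'' y _ hV' hy =>
      .eqRow (fun i => hV' (hx i)) hy, hk V' x M hV hx⟩

theorem RelExpr.closedIn_toQuery {n : ℕ} {a : Fin n → Sg.Srt} (R : RelExpr 𝒮 a) (V : Set (Var Sg))
    (N : ℕ) (k : (Fin n → ℕ) → ℕ → Query Sg)
    (hk : ∀ V' x M, V ⊆ V' → (∀ i, rowVar a x i ∈ V') → (k x M).ClosedIn V') :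
    (R.toQuery hsym N k).ClosedIn V := by
  induction R generalizing V N with
  | base r =>
    refine hk _ _ _ Set.subset_union_left fun i => ?_
    rw [vars_rowPattern]
    exact .inr ⟨i, rfl⟩
  | proj j R ih => exact ih V N _ fun V' x M hV hx => hk V' _ M hV fun i => hx (j i)
  | sel φ R ih =>
    exact ih V N _ fun V' x M hV hx => ⟨φ.closedIn_toCond hx, hk V' x M hV hx⟩
  | union R S ih ih' => exact ⟨ih V N k hk, ih' V N k hk⟩
  | prod R S ih ih' =>
    exact ih V N _ fun V' x M hV hx => ih' V' M _ fun V'' y M' hV' hy =>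
      hk V'' _ M' (hV.trans hV')
        (forall_rowVar_append (P := fun _ z => z ∈ V'') (fun i => hV' (hx i)) hy)
  | diff R S ih _ =>
    exact ih V N _ fun V' x M hV hx => ⟨S.closedIn_toCond hsym V' M _ fun V'' y _ hV' hy =>
      .eqRow (fun i => hV' (hx i)) hy, hk V' x M hV hx⟩

/-! ### Determinism of the translation -/

section Deterministic

variable (hD : D.IsFactAlgebra)
include hD

theorem RelExpr.detCond_toCond {n : ℕ} {a : Fin n → Sg.Srt} (R : RelExpr 𝒮 a) (N : ℕ)
    (k : (Fin n → ℕ) → ℕ → Cond Sg) (hk : ∀ x M, D.DetCond (k x M)) :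
    D.DetCond (R.toCond hsym N k) := by
  induction R generalizing N with
  | base r => exact ⟨detPattern_rowPattern hD (hsym r) _, hk _ _⟩
  | proj j R ih => exact ih N _ fun x M => hk _ _
  | sel φ R ih => exact ih N _ fun x M => ⟨trivial, hk _ _⟩
  | union R S ih ih' => exact ⟨ih N k hk, ih' N k hk⟩
  | prod R S ih ih' => exact ih N _ fun x M => ih' M _ fun y M' => hk _ _
  | diff R S ih ih' =>
    exact ih N _ fun x M => ⟨ih' M _ fun y _ => detCond_eqRow _ x y, hk _ _⟩

theorem RelExpr.detQuery_toQuery {n : ℕ} {a : Fin n → Sg.Srt} (R : RelExpr 𝒮 a) (N : ℕ)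
    (k : (Fin n → ℕ) → ℕ → Query Sg) (hk : ∀ x M, D.DetQuery (k x M)) :
    D.DetQuery (R.toQuery hsym N k) := by
  induction R generalizing N with
  | base r => exact ⟨detPattern_rowPattern hD (hsym r) _, hk _ _⟩
  | proj j R ih => exact ih N _ fun x M => hk _ _
  | sel φ R ih => exact ih N _ fun x M => ⟨trivial, hk _ _⟩
  | union R S ih ih' => exact ⟨ih N k hk, ih' N k hk⟩
  | prod R S ih ih' => exact ih N _ fun x M => ih' M _ fun y M' => hk _ _
  | diff R S ih _ =>
    exact ih N _ fun x M => ⟨S.detCond_toCond hsym hD M _ fun y _ => detCond_eqRow _ x y, hk _ _⟩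

end Deterministic

/-- The environment does not assign values to variables with indices at least `N`. -/
def Presentation.Env.Fresh (ρ : D.Env) (N : ℕ) : Prop := ∀ y : Var Sg, N ≤ y.idx → ρ y = none

/-- The environment `ρ'` extends `ρ`. -/
def Presentation.Env.Extends (ρ' ρ : D.Env) : Prop := ∀ y d, ρ y = some d → ρ' y = some d

/-- The new row occupies the indices from `N` to `N + n - 1`, so the bound moves to `N + n`. -/
theorem Presentation.Env.Fresh.row {ρ : D.Env} {N n : ℕ} (hρ : ρ.Fresh N) (a : Fin n → Sg.Srt)
    (t : Fin n → D.Val) : (ρ.row a (fun i => N + i) t).Fresh (N + n) := by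
  intro y hy
  rw [Env.row_of_notMem, hρ y (by omega)]
  rintro ⟨i, rfl⟩
  simp only [rowVar] at hy
  omega

/-- Freshness means that the new row overwrites no earlier value. -/
theorem Presentation.Env.Fresh.row_extends {ρ : D.Env} {N n : ℕ} (hρ : ρ.Fresh N)
    (a : Fin n → Sg.Srt) (t : Fin n → D.Val) : (ρ.row a (fun i => N + i) t).Extends ρ := by
  intro y d hy
  rw [Env.row_of_notMem, hy]
  rintro ⟨i, rfl⟩
  rw [hρ _ (by simp [rowVar])] at hy
  cases hy

theorem add_val_injective (N n : ℕ) : Function.Injective fun i : Fin n => N + (i : ℕ) :=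
  fun _ _ h => Fin.val_injective (Nat.add_left_cancel h)

/-! ### Correctness of the translation -/

variable (hD : D.IsFactAlgebra) (hdisj : ∀ r r', r ≠ r' →
  D.DisjointConstructors (sym r) (𝒮.cols r) (sym r') (𝒮.cols r')) (I : Database D 𝒮)
include hD hdisj

/-- Induction on `R` for all continuations at once. `Fresh` lets the continuation open further
iterations, and `Extends` guarantees that rows bound earlier keep their values there, as products
and differences require. -/
theorem RelExpr.cEvals_toCond {n : ℕ} {a : Fin n → Sg.Srt} (R : RelExpr 𝒮 a) {ρ : D.Env} {N : ℕ}
    (hρ : ρ.Fresh N) {k : (Fin n → ℕ) → ℕ → Cond Sg} {κ : (Fin n → D.Val) → Prop}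
    (hk : ∀ ρ' x M, Env.Fresh ρ' M → Env.Extends ρ' ρ → ∀ t, (∀ i, t i ∈ D.carrier (a i)) →
      (∀ i, ρ' (rowVar a x i) = some (t i)) → CEvals (I.toFacts sym) ρ' (k x M) (κ t)) :
    CEvals (I.toFacts sym) ρ (R.toCond hsym N k) (∃ t ∈ R.eval I, κ t) := by
  induction R generalizing ρ N with
  | base r =>
    have hx := add_val_injective N (𝒮.arity r)
    exact .ex_rowPattern hsym hD hx (fun i => hρ _ (Nat.le_add_right _ _)) hdisj I fun t ht =>
      hk _ _ _ (hρ.row _ t) (hρ.row_extends _ t) t (I.sorted r t ht) (Env.row_rowVar ρ hx t)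
  | proj j R ih =>
    refine (ih hρ (κ := fun t => κ (t ∘ j)) fun ρ' x M h1 h2 t ht h3 =>
      hk ρ' _ M h1 h2 (t ∘ j) (fun i => ht (j i)) fun i => h3 (j i)).congr ⟨?_, ?_⟩
    · rintro ⟨t, ht, h⟩
      exact ⟨_, ⟨t, ht, rfl⟩, h⟩
    · rintro ⟨_, ⟨t, ht, rfl⟩, h⟩
      exact ⟨t, ht, h⟩
  | sel φ R ih =>
    refine (ih hρ (κ := fun t => φ.Holds D t ∧ κ t) fun ρ' x M h1 h2 t ht h3 =>
      (CEvals.toCond hD ht h3 φ).and (hk ρ' x M h1 h2 t ht h3)).congr ?_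
    simp only [RelExpr.eval, Set.mem_ofPred_eq, and_assoc]
  | union R S ih ih' =>
    refine ((ih hρ hk).or (ih' hρ hk)).congr ?_
    simp only [RelExpr.eval, Set.mem_union, or_and_right, exists_or]
  | @prod n m a b R S ih ih' =>
    -- The continuation of `R` is the whole search through `S`; the values of the first row reach
    -- the innermost environment through `h2'`.
    refine (ih hρ (κ := fun t => ∃ s ∈ S.eval I, κ (Fin.append t s)) fun ρ' x M h1 h2 t ht h3 =>
      ih' h1 fun ρ'' y M' h1' h2' s hs h3' => hk ρ'' _ M' h1' (fun z d hz => h2' z d (h2 z d hz)) _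
        (append_sorted ht hs) (forall_rowVar_append (P := fun i z => ρ'' z = some (Fin.append t s i))
          (fun i => by simpa using h2' _ _ (h3 i)) (fun i => by simpa using h3' i))).congr ⟨?_, ?_⟩
    · rintro ⟨t, ht, s, hs, h⟩
      exact ⟨_, ⟨t, ht, s, hs, rfl⟩, h⟩
    · rintro ⟨_, ⟨t, ht, s, hs, rfl⟩, h⟩
      exact ⟨t, ht, s, hs, h⟩
  | diff R S ih ih' =>
    -- With row equality as its continuation, the condition for `S` says that the current row `t`
    -- belongs to `S`.
    refine (ih hρ (κ := fun t => ¬ (∃ s ∈ S.eval I, t = s) ∧ κ t) fun ρ' x M h1 h2 t ht h3 =>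
      (ih' h1 fun ρ'' y M' h1' h2' s hs h3' =>
        CEvals.eqRow hD ht (fun i => h2' _ _ (h3 i)) hs h3').neg.and
          (hk ρ' x M h1 h2 t ht h3)).congr ?_
    simp only [RelExpr.eval, Set.mem_sdiff, exists_eq_right', and_assoc]

/-- The induction of `RelExpr.cEvals_toCond` with sets of answers in place of truth values. In a
difference the subtracted expression occurs inside a condition, so the result for conditions is used
there. -/
theorem RelExpr.qEvals_toQuery {n : ℕ} {a : Fin n → Sg.Srt} (R : RelExpr 𝒮 a) {ρ : D.Env} {N : ℕ}
    (hρ : ρ.Fresh N) {k : (Fin n → ℕ) → ℕ → Query Sg} {K : (Fin n → D.Val) → Set D.Val}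
    (hk : ∀ ρ' x M, Env.Fresh ρ' M → Env.Extends ρ' ρ → ∀ t, (∀ i, t i ∈ D.carrier (a i)) →
      (∀ i, ρ' (rowVar a x i) = some (t i)) → QEvals (I.toFacts sym) ρ' (k x M) (K t)) :
    QEvals (I.toFacts sym) ρ (R.toQuery hsym N k) {d | ∃ t ∈ R.eval I, d ∈ K t} := by
  induction R generalizing ρ N with
  | base r =>
    have hx := add_val_injective N (𝒮.arity r)
    exact .from_rowPattern hsym hD hx (fun i => hρ _ (Nat.le_add_right _ _)) hdisj I fun t ht =>
      hk _ _ _ (hρ.row _ t) (hρ.row_extends _ t) t (I.sorted r t ht) (Env.row_rowVar ρ hx t)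
  | proj j R ih =>
    refine (ih hρ (K := fun t => K (t ∘ j)) fun ρ' x M h1 h2 t ht h3 =>
      hk ρ' _ M h1 h2 (t ∘ j) (fun i => ht (j i)) fun i => h3 (j i)).congr fun d => ⟨?_, ?_⟩
    · rintro ⟨t, ht, h⟩
      exact ⟨_, ⟨t, ht, rfl⟩, h⟩
    · rintro ⟨_, ⟨t, ht, rfl⟩, h⟩
      exact ⟨t, ht, h⟩
  | sel φ R ih =>
    refine (ih hρ (K := fun t => {d | φ.Holds D t ∧ d ∈ K t}) fun ρ' x M h1 h2 t ht h3 =>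
      .cond (CEvals.toCond hD ht h3 φ) (hk ρ' x M h1 h2 t ht h3)).congr fun d => ?_
    simp only [RelExpr.eval, Set.mem_ofPred_eq, and_assoc]
  | union R S ih ih' =>
    refine ((ih hρ hk).union (ih' hρ hk)).congr fun d => ?_
    simp only [RelExpr.eval, Set.mem_union, Set.mem_ofPred_eq, or_and_right, exists_or]
  | @prod n m a b R S ih ih' =>
    refine (ih hρ (K := fun t => {d | ∃ s ∈ S.eval I, d ∈ K (Fin.append t s)})
      fun ρ' x M h1 h2 t ht h3 => ih' h1 fun ρ'' y M' h1' h2' s hs h3' =>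
        hk ρ'' _ M' h1' (fun z d hz => h2' z d (h2 z d hz)) _ (append_sorted ht hs)
          (forall_rowVar_append (P := fun i z => ρ'' z = some (Fin.append t s i))
            (fun i => by simpa using h2' _ _ (h3 i)) (fun i => by simpa using h3' i))).congr
      fun d => ⟨?_, ?_⟩
    · rintro ⟨t, ht, s, hs, h⟩
      exact ⟨_, ⟨t, ht, s, hs, rfl⟩, h⟩
    · rintro ⟨_, ⟨t, ht, s, hs, rfl⟩, h⟩
      exact ⟨t, ht, s, hs, h⟩
  | diff R S ih _ =>
    refine (ih hρ (K := fun t => {d | ¬ (∃ s ∈ S.eval I, t = s) ∧ d ∈ K t})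
      fun ρ' x M h1 h2 t ht h3 => .cond (S.cEvals_toCond hsym hD hdisj I h1
        fun ρ'' y M' h1' h2' s hs h3' =>
          CEvals.eqRow hD ht (fun i => h2' _ _ (h3 i)) hs h3').neg
        (hk ρ' x M h1 h2 t ht h3)).congr fun d => ?_
    simp only [RelExpr.eval, Set.mem_sdiff, Set.mem_ofPred_eq, exists_eq_right', and_assoc]

omit hD hdisj in
-- Every run ends in an answer with the set of facts `T`, and answers are normal. So a possible
-- answer and every answer contain the same facts, and containing `d` means splitting as `F' + {d}`.
theorem Presentation.QEvals.normalizes_iff {F : Multiset D.Val} {Q : Query Sg} {T : Set D.Val}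
    (h : QEvals F (fun _ => none) Q T) (d : D.Val) :
    (∃ F', D.Normalizes (D.init Q F) (.ans (F' + {d}))) ↔ d ∈ T := by
  have hfin : Inevitable D.QStep
      (fun Z => ∃ M : Multiset D.Val, (∀ d, d ∈ M ↔ d ∈ T) ∧ Z = .ans M) (D.init Q F) := by
    refine (h 0 []).bind ?_
    rintro _ ⟨M, hM, rfl⟩
    exact .step_unique (.ans F _) (by rintro z ⟨⟩; rfl) (.here ⟨M, hM, by rw [zero_add]⟩)
  have hans : ∀ M, ¬ ∃ Z, D.QStep (.ans M) Z := by rintro M ⟨Z, ⟨⟩⟩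
  constructor
  · rintro ⟨F', hF', hn⟩
    obtain ⟨M, hM, heq⟩ := hfin.of_normal (by rintro _ ⟨M, -, rfl⟩; exact hans M) hF' hn
    cases heq
    exact (hM d).1 (by simp)
  · intro hd
    obtain ⟨_, hrun, M, hM, rfl⟩ := hfin.exists_reflTransGen
    obtain ⟨F', rfl⟩ := Multiset.exists_cons_of_mem ((hM d).2 hd)
    refine ⟨F', ?_, hans _⟩
    rwa [add_comm, Multiset.singleton_add]

end Translation

end QLang

/-! ### The translated query -/

theorem mainTheorem1 {Sg : QLang.Signature.{u, v}} (D : QLang.Presentation Sg)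
    (hD : D.IsFactAlgebra) (𝒮 : QLang.Schema.{u, v, w} Sg)
    (sym : ∀ {n : ℕ} {a : Fin n → Sg.Srt}, QLang.RelExpr 𝒮 a → Sg.Fn n)
    (hsym : ∀ {n : ℕ} {a : Fin n → Sg.Srt} (R : QLang.RelExpr 𝒮 a),
      D.IsFactConstructor (sym R) a)
    (hdisj : ∀ r r' : 𝒮.Rel, r ≠ r' →
      D.DisjointConstructors (sym (.base r)) (𝒮.cols r) (sym (.base r')) (𝒮.cols r'))
    {n : ℕ} {a : Fin n → Sg.Srt} (R : QLang.RelExpr 𝒮 a) :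
    ∃ Q : QLang.Query Sg, Q.Closed ∧ D.DetQuery Q ∧
      ∀ (I : QLang.Database D 𝒮) (t : Fin n → D.Val), (∀ i, t i ∈ D.carrier (a i)) →
        ((∃ F : Multiset D.Val,
            D.Normalizes (D.init Q (I.toFacts fun r => sym (.base r)))
              (.ans (F + {D.opVal (sym R) a t}))) ↔
          t ∈ R.eval I) := by
  have hbase := fun r : 𝒮.Rel => hsym (.base r)
  -- The continuation outputs the fact of the row. The bound 0 is allowed because the initial
  -- environment is empty.
  refine ⟨R.toQuery hbase 0 fun x _ => .fact (QLang.Presentation.rowFact (hsym R) x), ?_, ?_,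
    fun I t ht => ?_⟩
  · refine R.closedIn_toQuery hbase ∅ 0 _ fun V x _ _ hx => ?_
    show (QLang.rowTerm (sym R) a x).vars ⊆ V
    rw [QLang.vars_rowTerm]
    rintro _ ⟨i, rfl⟩
    exact hx i
  · exact R.detQuery_toQuery hbase hD 0 _ fun _ _ => trivial
  · have h := R.qEvals_toQuery hbase hD hdisj I (ρ := fun _ => none) (N := 0) (fun _ _ => rfl)
      (K := fun t => {D.opVal (sym R) a t}) fun ρ x _ _ _ t ht hx =>
        .fact (f := QLang.Presentation.rowFact (hsym R) x)
          (QLang.Presentation.denotes_rowTerm ht hx)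
    rw [h.normalizes_iff]
    constructor
    · rintro ⟨t', ht', heq⟩
      -- Distinct rows give distinct output facts, so the row behind the answer is `t` itself.
      rwa [(hsym R).opVal_inj ht (R.eval_sorted I t' ht') heq]
    · exact fun h => ⟨t, h, rfl⟩
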